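/- All tournaments are finite. The backedge graph of a tournament $T$ with respect to a total order $<$ of $V(T)$ is the graph on $V(T)$ in which $x<y$ are adjacent iff $yx$ is an arc of $T$; the clique number $\overrightarrow{\omega}(T)$ is the minimum, over all total orders, of the clique number of the backedge graph, and $\overrightarrow{\omega}(X)=\overrightarrow{\omega}(T[X])$ for $X\subseteq V(T)$. $T$ contains (a copy of) $H$ if some induced subtournament of $T$ is isomorphic to $H$; otherwise $T$ is $H$-free. $D_1$ is a single vertex, and $D_n$ is the disjoint union of two copies $X,Y$ of $D_{n-1}$ and a vertex $v$ with all arcs from $X$ to $Y$, from $Y$ to $v$ and from $v$ to $X$. $A_1$ is a single vertex, and $A_n$ is the disjoint union of copies $T_1,\dots,T_{n-1}$ of $A_{n-1}$ and vertices $v_1,\dots,v_n$, with all arcs from $v_j$ to $v_i$ and from $T_i$ to $T_j$ for $i<j$, from $v_i$ to $T_j$ for $i\le j$, and from $T_j$ to $v_i$ for $i>j$. For positive integers $l,c$, an $(l,c)$-bag-chain of length $t$ in $T$ is a tuple $(B_1,\dots,B_t)$ of pairwise disjoint subsets of $V(T)$ with $\overrightarrow{\omega}(B_i)=l$ for all $i$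 such that for all $i<j$: $\overrightarrow{\omega}(N^+(v)\cap B_i)<c$ for every $v\in B_j$, and $\overrightarrow{\omega}(N^-(w)\cap B_j)<c$ for every $w\in B_i$. (There is no $(l,c)$-bag-chain if $l=0$ or $c=0$.) For $n\ge 2$ and integers $l,c\ge 0$, call an integer $K\ge 0$ an admissible constant for $(n,l,c)$ if for every tournament $T$ such that every nonempty subtournament $T'$ of $T$ with $\overrightarrow{\omega}(T')\ge c$ contains $D_{n-1}$, at least one of the following holds: $\overrightarrow{\omega}(T)<K$; $T$ contains $D_n$; $T$ has an $(l,c)$-bag-chain of length $8$. **Theorem.** (1) There is a function $C(l,c)$ from pairs of nonnegative integers to nonnegative integers, nondecreasing in each argument, such that $C(l,c)$ is an admissible constant for $(n,l,c)$ for all $n\ge 2$ and all $l,c\ge 0$ with $l\ge 1$ or $c=0$. (2) Let $m,n\ge 2$, $c_{\mathrm{small}}\ge 0$ and $c_{\mathrm{large}}\ge 2^n c_{\mathrm{small}}$ be integers, and let $K$ be any admissible constant for $(n,c_{\mathrm{large}},c_{\mathrm{small}})$ (for example $K=C(c_{\mathrm{large}},c_{\mathrm{small}})$ with $C$ as in (1)).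 Let $T$ be an $A_m$-free and $D_n$-free tournament such that every nonempty subtournament $T'$ of $T$ with $\overrightarrow{\omega}(T')\ge c_{\mathrm{small}}$ contains both $A_{m-1}$ and $D_{n-1}$. Then $$\overrightarrow{\omega}(T)\le 16m\max\{c_{\mathrm{large}},\,K,\,(4\cdot m!+1)\,c_{\mathrm{small}}\}.$$ -/

import Mathlib

universe u v w

/-- A tournament on the vertex set `V`: a digraph (`T.Adj x y` means that `xy` is an arc) with
exactly one arc between any two distinct vertices, and no loops. -/
structure Tournament (V : Type u) extends Digraph V where
  asymm : ∀ x y : V, Adj x y → ¬ Adj y x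
  total : ∀ x y : V, x ≠ y → Adj x y ∨ Adj y x

namespace Tournament

/-- The subtournament `T[S]` induced by a set of vertices. -/
def induce {V : Type u} (T : Tournament V) (S : Set V) : Tournament S where
  Adj x y := T.Adj x.1 y.1
  asymm x y h := T.asymm x.1 y.1 h
  total x y h := T.total x.1 y.1 fun h' => h (Subtype.ext h')

/-- `T` contains a copy of `H`: some induced subtournament of `T` is isomorphic to `H`.
`T` is `H`-free if this fails. -/
def Contains {V : Type u} {W : Type v} (T : Tournament V) (H : Tournament W) : Prop :=
  Nonempty (H.Adj ↪r T.Adj)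

/-- The out-neighbourhood `N⁺(x)`. -/
def outNbr {V : Type u} (T : Tournament V) (x : V) : Set V := {y | T.Adj x y}

/-- The in-neighbourhood `N⁻(x)`. -/
def inNbr {V : Type u} (T : Tournament V) (x : V) : Set V := {y | T.Adj y x}

/-- The backedge graph of `T` with respect to a total order on the vertices: `x` and `y` with
`x < y` are adjacent iff `yx` is an arc. -/
def backedgeGraph {V : Type u} (T : Tournament V) (o : LinearOrder V) : SimpleGraph V where
  Adj x y := (o.lt x y ∧ T.Adj y x) ∨ (o.lt y x ∧ T.Adj x y)
  symm := ⟨fun _ _ h => h.symm⟩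
  loopless := ⟨fun x h => by
    rcases h with h | h <;> exact T.asymm x x h.2 h.2⟩

/-- The clique number of a (finite) tournament: the least clique number of a backedge graph. -/
noncomputable def cliqueNumber {V : Type u} (T : Tournament V) : ℕ :=
  sInf (Set.range fun o : LinearOrder V => (T.backedgeGraph o).cliqueNum)

/-- The clique number `ω(X) = ω(T[X])` of a set of vertices. -/
noncomputable def omega {V : Type u} (T : Tournament V) (X : Set V) : ℕ :=
  (T.induce X).cliqueNumber

/-- The tournament with a single vertex. -/
def single : Tournament Unit where
  Adj _ _ := False
  asymm _ _ h := h.elim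
  total x y h := (h (Subsingleton.elim x y)).elim

/-- The tournament without vertices. -/
def null : Tournament Empty where
  Adj _ _ := False
  asymm _ _ h := h.elim
  total x _ _ := x.elim

/-- The arcs of `Δ(T₁, T₂, T₃)`. -/
def DeltaAdj {U : Type u} {V : Type v} {W : Type w}
    (T₁ : Tournament U) (T₂ : Tournament V) (T₃ : Tournament W) :
    U ⊕ V ⊕ W → U ⊕ V ⊕ W → Prop
  | .inl x, .inl y => T₁.Adj x y
  | .inr (.inl x), .inr (.inl y) => T₂.Adj x y
  | .inr (.inr x), .inr (.inr y) => T₃.Adj x y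
  | .inl _, .inr (.inl _) => True
  | .inr (.inl _), .inr (.inr _) => True
  | .inr (.inr _), .inl _ => True
  | _, _ => False

/-- `Δ(T₁, T₂, T₃)`: the disjoint union of `T₁`, `T₂`, `T₃`, with all arcs from `T₁` to `T₂`,
from `T₂` to `T₃` and from `T₃` to `T₁`. -/
def Delta {U : Type u} {V : Type v} {W : Type w}
    (T₁ : Tournament U) (T₂ : Tournament V) (T₃ : Tournament W) : Tournament (U ⊕ V ⊕ W) where
  Adj := DeltaAdj T₁ T₂ T₃
  asymm := by
    rintro (x | x | x) (y | y | y) <;> simp only [DeltaAdj] <;> first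
      | exact T₁.asymm x y
      | exact T₂.asymm x y
      | exact T₃.asymm x y
      | simp
  total := by
    rintro (x | x | x) (y | y | y) h <;> simp only [DeltaAdj] <;> first
      | exact T₁.total x y fun h' => h (by rw [h'])
      | exact T₂.total x y fun h' => h (by rw [h'])
      | exact T₃.total x y fun h' => h (by rw [h'])
      | simp

/-- The arcs of the tournament `interleave H k`. -/
def InterleaveAdj {W : Type w} (H : Tournament W) (k : ℕ) :
    (Fin k × W) ⊕ Fin (k + 1) → (Fin k × W) ⊕ Fin (k + 1) → Prop
  | .inl (i, x), .inl (j, y) => i < j ∨ (i = j ∧ H.Adj x y)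
  | .inr i, .inr j => j < i
  | .inr i, .inl (j, _) => i.val ≤ j.val
  | .inl (j, _), .inr i => j.val < i.val

/-- `k` disjoint copies `T_0, …, T_{k-1}` of `H` (the vertices `inl (j, x)` with `x` in `H` form
`T_j`), and `k + 1` more vertices `v_0, …, v_k` (`v_i` is `inr i`), with all arcs from `T_i` to
`T_j` and from `v_j` to `v_i` for `i < j`, from `v_i` to `T_j` for `i ≤ j`, and from `T_j` to
`v_i` for `j < i`. -/
def interleave {W : Type w} (H : Tournament W) (k : ℕ) :
    Tournament ((Fin k × W) ⊕ Fin (k + 1)) where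
  Adj := InterleaveAdj H k
  asymm := by
    rintro (⟨i, x⟩ | i) (⟨j, y⟩ | j) <;> simp only [InterleaveAdj]
    · rintro (h | ⟨rfl, h⟩) (h' | ⟨h', h''⟩)
      · exact lt_asymm h h'
      · exact absurd h (by simp [h'])
      · exact lt_irrefl _ h'
      · exact H.asymm x y h h''
    · omega
    · omega
    · exact fun h => lt_asymm h
  total := by
    rintro (⟨i, x⟩ | i) (⟨j, y⟩ | j) h <;> simp only [InterleaveAdj]
    · rcases lt_trichotomy i j with h' | rfl | h'
      · exact Or.inl (Or.inl h')
      · rcases H.total x y fun h' => h (by rw [h']) with h' | h'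
        · exact Or.inl (Or.inr ⟨rfl, h'⟩)
        · exact Or.inr (Or.inr ⟨rfl, h'⟩)
      · exact Or.inr (Or.inl h')
    · omega
    · omega
    · exact (lt_or_gt_of_ne fun h' => h (by rw [h'])).symm

/-- The vertex set of `A_n`. -/
def AVert : ℕ → Type
  | 0 => Empty
  | n + 1 => (Fin n × AVert n) ⊕ Fin (n + 1)

/-- The tournaments `A_n`: `A_1` is a single vertex, and `A_n` is built from `n - 1` copies of
`A_{n-1}` and `n` further vertices. With the convention that `A_0` has no vertices, the recursive
step also produces the one-vertex tournament `A_1`. -/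
def A : (n : ℕ) → Tournament (AVert n)
  | 0 => null
  | n + 1 => interleave (A n) n

/-- The vertex set of `D_n`. -/
def DVert : ℕ → Type
  | 0 => Empty
  | n + 1 => DVert n ⊕ DVert n ⊕ Unit

/-- The tournaments `D_n`: `D_1` is a single vertex and `D_n = Δ(D_{n-1}, D_{n-1}, D_1)`. With the
convention that `D_0` has no vertices, the recursive step also produces the one-vertex tournament
`D_1`. -/
def D : (n : ℕ) → Tournament (DVert n)
  | 0 => null
  | n + 1 => Delta (D n) (D n) single

/-- `(B_1, …, B_t)` is a `(c, a)`-bag-chain in `T`, for positive integers `c` and `a`. -/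
structure IsBagChain {V : Type u} (T : Tournament V) (c a : ℕ) {t : ℕ} (B : Fin t → Set V) :
    Prop where
  pos_left : 0 < c
  pos_right : 0 < a
  disjoint : ∀ i j, i ≠ j → Disjoint (B i) (B j)
  omega_eq : ∀ i, T.omega (B i) = c
  omega_out_lt : ∀ i j, i < j → ∀ x ∈ B j, T.omega (T.outNbr x ∩ B i) < a
  omega_in_lt : ∀ i j, i < j → ∀ y ∈ B i, T.omega (T.inNbr y ∩ B j) < a

/-- Every (nonempty) subtournament of `T` with clique number at least `c` contains `H`. -/
def LargeSubContain {V : Type u} {W : Type v} (T : Tournament V) (c : ℕ) (H : Tournament W) :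
    Prop :=
  ∀ S : Set V, S.Nonempty → c ≤ T.omega S → (T.induce S).Contains H

/-- `K` is an admissible value of the bag-chain constant `C(l, c)` for `D_n`-free tournaments:
for every finite tournament `T` in which every subtournament with clique number at least `c`
contains `D_{n-1}`, either the clique number of `T` is less than `K`, or `T` contains `D_n`, or
there is an `(l, c)`-bag-chain of length 8 in `T`. -/
def IsBagChainConstant (n l c K : ℕ) : Prop :=
  ∀ (V : Type u) [Finite V] (T : Tournament V), T.LargeSubContain c (D (n - 1)) →
    T.cliqueNumber < K ∨ T.Contains (D n) ∨ ∃ B : Fin 8 → Set V, T.IsBagChain l c B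

end Tournament

/-! Vertices are ranked by natural numbers, and a clique of the backedge graph is a set in which
higher vertices dominate lower ones.

Upper bound (2). Let `M` be the maximum in the statement. If `T` is `D_n`-free and large sets
contain `D_{n-1}`, there is no arrangement `v → X → Y → v` with `X` and `Y` large; `DeltaFree`
abstracts this. Take a longest bag-chain. The exclusion of such arrangements gives each vertex a
position along the bags (`DeltaFree.exists_zone`), and sets of vertices at least three positions
apart satisfy the bag-chain inequalities (`DeltaFree.forward_of_zone`). Vertices sharing a position
span no bag-chain of length 8, since it could replace at most five bags of the longest chain; so the
clique number there is at most `M`. Merging consecutive positions gives layers of clique number at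
most `2M`, and at least `M` except for the top one (`DeltaFree.exists_layers`). If a set with all
arcs between its layers going backwards met more than `6(m-1)` layers, it would supply the vertices
`v_i` of `A_m`, and full layers between them would have room for the copies of `A_{m-1}`
(`contains_interleave_of_layers`). Hence a clique has at most `2M · 6(m-1)` vertices.

The constant (1). It suffices to split every set of huge clique number into two large sets forming a
bag-chain, and to iterate three times. The splitting rests on two growth facts. First, deeply nested
cyclic triangles force large clique number (`lt_omega_of_nest`). Second, large domination number
forces a bounded set of large clique number (`exists_hasCluster_of_undom`), so a set of huge clique
number has a vertex with both neighbourhoods large (`exists_both_large`). If no splitting exists,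
the set contains deeply nested triangles, hence a bounded subset `M` of clique number at least `3c`.
Since `M` is bounded, the pigeonhole principle gives large sets `P` and `R` that are homogeneous to
parts of `M`. Excluding cyclic arrangements leaves a large part of `M` that is dominated by `P` and
dominates `R`, and this makes `(P, R)` a bag-chain after all (`exists_hasForwardPair`). The constant
does not depend on `n`: `D_n` has unbounded clique number, so large `n` contradicts the hypothesis
on subtournaments. -/

namespace Tournament

/-- `Q` is a clique of the backedge graph for the order in which the vertices are ranked by `f`. -/
def BackClique {V : Type u} (T : Tournament V) (f : V → ℕ) (Q : Finset V) : Prop :=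
  ∀ x ∈ Q, ∀ y ∈ Q, f x < f y → T.Adj y x

/-- All arcs between `X` and `Y` go from `X` to `Y`. -/
def Complete {V : Type u} (T : Tournament V) (X Y : Set V) : Prop :=
  ∀ x ∈ X, ∀ y ∈ Y, T.Adj x y

/-! ### Clique numbers through rankings by natural numbers -/

section Basic

variable {V : Type u} {W : Type v} (T : Tournament V)

theorem irrefl (x : V) : ¬ T.Adj x x := fun h => T.asymm x x h h

theorem ne_of_adj {x y : V} (h : T.Adj x y) : x ≠ y := by
  rintro rfl
  exact T.irrefl _ h

theorem adj_of_not_adj {x y : V} (hne : x ≠ y) (h : ¬ T.Adj x y) : T.Adj y x :=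
  (T.total x y hne).resolve_left h

/-- Distinct vertices of `H` are joined by an arc, so an arc-preserving map is injective and
reflects arcs. -/
theorem contains_of_hom {H : Tournament W} (φ : W → V)
    (h : ∀ a b, H.Adj a b → T.Adj (φ a) (φ b)) : T.Contains H := by
  refine ⟨⟨⟨φ, ?_⟩, ?_⟩⟩
  · intro a b hab
    by_contra hne
    rcases H.total a b hne with h' | h'
    · exact T.ne_of_adj (h _ _ h') hab
    · exact T.ne_of_adj (h _ _ h') hab.symm
  · intro a b
    refine ⟨fun h' => ?_, h a b⟩
    by_contra hn
    have hne : a ≠ b := by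
      rintro rfl
      exact T.irrefl _ h'
    exact T.asymm _ _ h' (h _ _ (H.adj_of_not_adj hne hn))

theorem BackClique.mono {T : Tournament V} {f : V → ℕ} {Q Q' : Finset V}
    (h : T.BackClique f Q) (hQ : Q' ⊆ Q) : T.BackClique f Q' :=
  fun x hx y hy => h x (hQ hx) y (hQ hy)

/-- Two cliques, the first below the second, with all arcs from the second to the first. -/
theorem BackClique.union [DecidableEq V] {T : Tournament V} {f : V → ℕ} {Q R : Finset V}
    (hQ : T.BackClique f Q) (hR : T.BackClique f R)
    (hf : ∀ x ∈ Q, ∀ y ∈ R, f x < f y) (ha : ∀ x ∈ Q, ∀ y ∈ R, T.Adj y x) :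
    T.BackClique f (Q ∪ R) := by
  intro x hx y hy hxy
  rcases Finset.mem_union.1 hx with hx | hx <;> rcases Finset.mem_union.1 hy with hy | hy
  · exact hQ x hx y hy hxy
  · exact ha x hx y hy
  · exact absurd hxy (hf y hy x hx).not_gt
  · exact hR x hx y hy hxy

theorem BackClique.singleton (f : V → ℕ) (x : V) : T.BackClique f {x} := by
  intro y hy z hz h
  rw [Finset.mem_singleton] at hy hz
  subst hy hz
  exact absurd h (lt_irrefl _)

/-- Replaces linear orders by injective rankings into `ℕ`, which can be restricted, concatenated and
reversed by arithmetic. One direction ranks a vertex by its number of predecessors. -/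
theorem cliqueNumber_le_iff [Finite V] (k : ℕ) :
    T.cliqueNumber ≤ k ↔ ∃ f : V → ℕ, Function.Injective f ∧
      ∀ Q : Finset V, T.BackClique f Q → Q.card ≤ k := by
  classical
  have := Fintype.ofFinite V
  constructor
  · intro h
    have hne : (Set.range fun o : LinearOrder V => (T.backedgeGraph o).cliqueNum).Nonempty :=
      ⟨_, LinearOrder.lift' (Finite.equivFin V) (Finite.equivFin V).injective, rfl⟩
    obtain ⟨o, ho⟩ := Nat.sInf_mem hne
    have hk : (T.backedgeGraph o).cliqueNum ≤ k := le_trans (le_of_eq ho) h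
    let g : V → ℕ := fun v => (Finset.univ.filter fun z : V => o.lt z v).card
    have hg : ∀ a b : V, o.lt a b → g a < g b := by
      intro a b hab
      refine Finset.card_lt_card ⟨?_, ?_⟩
      · intro z hz
        simp only [Finset.mem_filter, Finset.mem_univ, true_and] at hz ⊢
        exact @lt_trans V o.toPreorder _ _ _ hz hab
      · intro hs
        have : a ∈ Finset.univ.filter fun z : V => o.lt z a := hs (by simpa using hab)
        simp only [Finset.mem_filter, Finset.mem_univ, true_and] at this
        exact @lt_irrefl V o.toPreorder a this
    have hlt : ∀ a b : V, g a < g b → o.lt a b := by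
      intro a b hab
      rcases @lt_trichotomy V o a b with h1 | h1 | h1
      · exact h1
      · rw [h1] at hab
        exact absurd hab (lt_irrefl _)
      · exact absurd (hg _ _ h1) hab.not_gt
    have hinj : Function.Injective g := by
      intro a b hab
      rcases @lt_trichotomy V o a b with h1 | h1 | h1
      · exact absurd hab (hg _ _ h1).ne
      · exact h1
      · exact absurd hab (hg _ _ h1).ne'
    refine ⟨g, hinj, fun Q hc => ?_⟩
    have hcl : (T.backedgeGraph o).IsClique Q := by
      intro a ha b hb hab
      rcases lt_or_gt_of_ne (fun h => hab (hinj h)) with h1 | h1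
      · exact Or.inl ⟨hlt _ _ h1, hc _ ha _ hb h1⟩
      · exact Or.inr ⟨hlt _ _ h1, hc _ hb _ ha h1⟩
    exact hcl.card_le_cliqueNum.trans hk
  · rintro ⟨f, hf, hk⟩
    let o : LinearOrder V := LinearOrder.lift' f hf
    have hlt : ∀ a b : V, o.lt a b ↔ f a < f b := fun a b => Iff.rfl
    refine le_trans (Nat.sInf_le (Set.mem_range_self o)) ?_
    obtain ⟨s, hs⟩ := (T.backedgeGraph o).exists_isNClique_cliqueNum
    show (T.backedgeGraph o).cliqueNum ≤ k
    rw [← hs.card_eq]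
    refine hk _ ?_
    intro a ha b hb hxy
    have hne : a ≠ b := by
      rintro rfl
      exact lt_irrefl _ hxy
    rcases hs.isClique ha hb hne with h1 | h1
    · exact h1.2
    · exact absurd ((hlt _ _).1 h1.1) (lt_asymm hxy)

theorem omega_le_iff [Finite V] (X : Set V) (k : ℕ) :
    T.omega X ≤ k ↔ ∃ f : V → ℕ, Set.InjOn f X ∧
      ∀ Q : Finset V, ↑Q ⊆ X → T.BackClique f Q → Q.card ≤ k := by
  classical
  refine ((T.induce X).cliqueNumber_le_iff k).trans ⟨?_, ?_⟩
  · rintro ⟨g, hg, hk⟩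
    let f : V → ℕ := fun v => if h : v ∈ X then g ⟨v, h⟩ else 0
    have hf : ∀ a : X, f a = g a := fun a => by simp [f]
    refine ⟨f, fun a ha b hb hab => ?_, fun Q hQ hc => ?_⟩
    · have h1 := hf ⟨a, ha⟩
      have h2 := hf ⟨b, hb⟩
      exact congrArg Subtype.val (hg (h1.symm.trans (hab.trans h2)))
    · have : (Q.subtype (· ∈ X)).card = Q.card := by
        rw [Finset.card_subtype, Finset.filter_true_of_mem]
        exact fun x hx => hQ hx
      rw [← this]
      refine hk _ fun a ha b hb hab => ?_
      rw [← hf, ← hf] at hab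
      exact hc a (by simpa using ha) b (by simpa using hb) hab
  · rintro ⟨f, hf, hk⟩
    refine ⟨fun x => f x, fun a b hab => Subtype.ext (hf a.2 b.2 hab), fun Q hc => ?_⟩
    rw [← Finset.card_map (Function.Embedding.subtype (· ∈ X))]
    refine hk _ ?_ ?_
    · intro x hx
      obtain ⟨y, -, rfl⟩ := Finset.mem_map.1 (Finset.mem_coe.1 hx)
      exact y.2
    · intro x hx y hy hxy
      obtain ⟨a, ha, rfl⟩ := Finset.mem_map.1 hx
      obtain ⟨b, hb, rfl⟩ := Finset.mem_map.1 hy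
      exact hc a ha b hb hxy

theorem lt_omega_iff [Finite V] (X : Set V) (k : ℕ) :
    k < T.omega X ↔ ∀ f : V → ℕ, Set.InjOn f X →
      ∃ Q : Finset V, ↑Q ⊆ X ∧ T.BackClique f Q ∧ k < Q.card := by
  rw [← not_le, omega_le_iff]
  push Not
  rfl

theorem exists_backClique_of_le_omega [Finite V] {X : Set V} {k : ℕ} (h : k ≤ T.omega X)
    {f : V → ℕ} (hf : Set.InjOn f X) :
    ∃ Q : Finset V, ↑Q ⊆ X ∧ T.BackClique f Q ∧ Q.card = k := by
  rcases Nat.eq_zero_or_pos k with rfl | hk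
  · exact ⟨∅, by simp, by simp [BackClique], rfl⟩
  · obtain ⟨Q, hQ, hc, hcard⟩ := (T.lt_omega_iff X (k - 1)).1 (by omega) f hf
    obtain ⟨R, hR, hRc⟩ := Finset.exists_subset_card_eq (s := Q) (n := k) (by omega)
    exact ⟨R, fun x hx => hQ (hR hx), hc.mono hR, hRc⟩

theorem omega_mono [Finite V] {X Y : Set V} (h : X ⊆ Y) : T.omega X ≤ T.omega Y := by
  obtain ⟨f, hf, hk⟩ := (T.omega_le_iff Y _).1 le_rfl
  exact (T.omega_le_iff X _).2 ⟨f, hf.mono h, fun Q hQ => hk Q (hQ.trans h)⟩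

/-- The concatenation of optimal orders of the parts of a partition. -/
theorem omega_le_of_parts [Finite V] (X : Set V) (g : V → ℕ) (w : ℕ → ℕ) (k : ℕ)
    (hw : ∀ a, T.omega (X ∩ g ⁻¹' {a}) ≤ w a)
    (hk : ∀ Q : Finset V, ↑Q ⊆ X → (∀ x ∈ Q, ∀ y ∈ Q, g x < g y → T.Adj y x) →
      (∀ a, (Q.filter fun x => g x = a).card ≤ w a) → Q.card ≤ k) :
    T.omega X ≤ k := by
  classical
  have := Fintype.ofFinite V
  choose f hf hfk using fun a => (T.omega_le_iff _ _).1 (hw a)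
  -- `N` exceeds every rank inside a part, so `g x * N + f (g x) x` is the lexicographic ranking.
  obtain ⟨N, hN⟩ : ∃ N, ∀ x : V, f (g x) x < N := by
    refine ⟨(Finset.univ.sup fun x : V => f (g x) x) + 1, fun x => ?_⟩
    exact Nat.lt_succ_of_le (Finset.le_sup (f := fun x : V => f (g x) x) (Finset.mem_univ x))
  have key : ∀ x y, g x < g y → g x * N + f (g x) x < g y * N + f (g y) y := by
    intro x y h
    have h1 : (g x + 1) * N ≤ g y * N := Nat.mul_le_mul_right _ h
    have h2 := hN x
    rw [add_mul, one_mul] at h1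
    omega
  refine (T.omega_le_iff X k).2 ⟨fun x => g x * N + f (g x) x, ?_, ?_⟩
  · intro x hx y hy hxy
    rcases lt_trichotomy (g x) (g y) with h | h | h
    · exact absurd hxy (key _ _ h).ne
    · simp only [h, add_right_inj] at hxy
      exact hf (g y) ⟨hx, h⟩ ⟨hy, rfl⟩ hxy
    · exact absurd hxy (key _ _ h).ne'
  · intro Q hQ hc
    refine hk Q hQ (fun x hx y hy h => hc x hx y hy (key _ _ h)) fun a => ?_
    refine hfk a _ ?_ ?_
    · intro x hx
      simp only [Finset.coe_filter, Set.mem_ofPred_eq] at hx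
      exact ⟨hQ hx.1, hx.2⟩
    · intro x hx y hy hxy
      simp only [Finset.mem_filter] at hx hy
      refine hc x hx.1 y hy.1 ?_
      simp only [hx.2, hy.2]
      omega

theorem omega_union_le [Finite V] (X Y : Set V) : T.omega (X ∪ Y) ≤ T.omega X + T.omega Y := by
  classical
  refine T.omega_le_of_parts _ (fun x => if x ∈ X then 0 else 1)
    (fun a => if a = 0 then T.omega X else T.omega Y) _ ?_ ?_
  · intro a
    by_cases ha : a = 0
    · subst ha
      simp only [if_true]
      refine T.omega_mono ?_
      rintro x ⟨-, hx⟩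
      by_contra hn
      simp [hn] at hx
    · simp only [ha, if_false]
      refine T.omega_mono ?_
      rintro x ⟨hx, hxa⟩
      refine hx.resolve_left fun hn => ha ?_
      simpa [hn] using hxa.symm
  · intro Q _ _ hc
    have h0 := hc 0
    have h1 := hc 1
    simp only [if_true, one_ne_zero, if_false] at h0 h1
    rw [← Finset.card_filter_add_card_filter_not (s := Q) (fun x => (if x ∈ X then 0 else 1) = 0)]
    refine add_le_add h0 (le_trans (Finset.card_le_card ?_) h1)
    intro x hx
    simp only [Finset.mem_filter] at hx ⊢
    refine ⟨hx.1, ?_⟩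
    by_cases h : x ∈ X <;> simp [h] at hx ⊢

theorem omega_empty [Finite V] : T.omega (∅ : Set V) = 0 := by
  refine Nat.le_zero.1 ((T.omega_le_iff _ _).2 ⟨fun _ => 0, by simp, fun Q hQ _ => ?_⟩)
  rw [Set.subset_empty_iff, Finset.coe_eq_empty] at hQ
  simp [hQ]

theorem omega_singleton_le [Finite V] (x : V) : T.omega {x} ≤ 1 := by
  refine (T.omega_le_iff _ _).2 ⟨fun _ => 0, by simp, fun Q hQ _ => ?_⟩
  exact Finset.card_le_one.2 fun a ha b hb => (hQ ha).trans (hQ hb).symm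

theorem nonempty_of_omega_pos [Finite V] {X : Set V} (h : 0 < T.omega X) : X.Nonempty := by
  by_contra hn
  rw [Set.not_nonempty_iff_eq_empty] at hn
  rw [hn, omega_empty] at h
  exact lt_irrefl _ h

theorem omega_pos_of_mem [Finite V] {X : Set V} {x : V} (h : x ∈ X) : 0 < T.omega X := by
  refine (T.lt_omega_iff _ _).2 fun f _ => ⟨{x}, by simpa using h, BackClique.singleton T f x, ?_⟩
  simp

theorem omega_insert_le [Finite V] (x : V) (X : Set V) : T.omega (insert x X) ≤ T.omega X + 1 := by
  rw [Set.insert_eq, add_comm]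
  exact (T.omega_union_le _ _).trans (Nat.add_le_add_right (T.omega_singleton_le x) _)

theorem omega_le_diff_add [Finite V] (X Y : Set V) :
    T.omega X ≤ T.omega (X \ Y) + T.omega (X ∩ Y) := by
  refine le_trans (T.omega_mono ?_) (T.omega_union_le _ _)
  rw [Set.sdiff_union_inter]

theorem omega_biUnion_le [Finite V] {ι : Type w} (s : Finset ι) (X : ι → Set V) (c : ℕ)
    (h : ∀ i ∈ s, T.omega (X i) ≤ c) : T.omega (⋃ i ∈ s, X i) ≤ s.card * c := by
  classical
  induction s using Finset.induction_on with
  | empty => simp [omega_empty]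
  | insert a s ha ih =>
    rw [Finset.set_biUnion_insert, Finset.card_insert_of_notMem ha, add_mul, one_mul, add_comm]
    refine (T.omega_union_le _ _).trans (add_le_add (h a (Finset.mem_insert_self _ _)) (ih ?_))
    exact fun i hi => h i (Finset.mem_insert_of_mem hi)

/-- A set with a given smaller clique number can be found inside any set. -/
theorem exists_subset_omega_eq [Finite V] (X : Set V) {l : ℕ} (h : l ≤ T.omega X) :
    ∃ Y ⊆ X, T.omega Y = l := by
  induction X, Set.toFinite X using Set.Finite.induction_on with
  | empty =>
    refine ⟨∅, subset_rfl, ?_⟩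
    rw [omega_empty] at h ⊢
    omega
  | @insert a s _ _ ih =>
    -- Adding `a` raises the clique number by at most one: if `s` falls short of `l`, then `insert a
    -- s` hits it exactly.
    rcases Nat.lt_or_ge (T.omega s) l with h' | h'
    · exact ⟨_, subset_rfl, by have := T.omega_insert_le a s; omega⟩
    · obtain ⟨Y, hY, hl⟩ := ih h'
      exact ⟨Y, hY.trans (Set.subset_insert _ _), hl⟩

/-- The clique number of the image of a homomorphism. -/
theorem omega_le_omega_of_hom [Finite V] [Finite W] {H : Tournament W} (φ : W → V)
    (h : ∀ a b, H.Adj a b → T.Adj (φ a) (φ b)) {X : Set W} {Y : Set V} (hXY : ∀ x ∈ X, φ x ∈ Y) :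
    H.omega X ≤ T.omega Y := by
  classical
  obtain ⟨f, hf, hk⟩ := (T.omega_le_iff Y _).1 le_rfl
  have hinj : Function.Injective φ := by
    intro a b hab
    by_contra hne
    rcases H.total a b hne with h' | h'
    · exact T.ne_of_adj (h _ _ h') hab
    · exact T.ne_of_adj (h _ _ h') hab.symm
  refine (H.omega_le_iff X _).2 ⟨f ∘ φ, ?_, ?_⟩
  · exact fun a ha b hb hab => hinj (hf (hXY a ha) (hXY b hb) hab)
  · intro Q hQ hc
    rw [← Finset.card_image_of_injective Q hinj]
    refine hk _ ?_ ?_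
    · intro x hx
      obtain ⟨a, ha, rfl⟩ := Finset.mem_image.1 (Finset.mem_coe.1 hx)
      exact hXY a (hQ ha)
    · intro x hx y hy hxy
      obtain ⟨a, ha, rfl⟩ := Finset.mem_image.1 hx
      obtain ⟨b, hb, rfl⟩ := Finset.mem_image.1 hy
      exact h _ _ (hc a ha b hb hxy)

theorem omega_induce [Finite V] (S : Set V) (X : Set S) :
    (T.induce S).omega X = T.omega (Subtype.val '' X) := by
  apply le_antisymm
  · exact T.omega_le_omega_of_hom Subtype.val (fun a b h => h) fun x hx => ⟨x, hx, rfl⟩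
  · obtain ⟨f, hf, hk⟩ := ((T.induce S).omega_le_iff X _).1 le_rfl
    classical
    let g : V → ℕ := fun v => if h : v ∈ S then f ⟨v, h⟩ else 0
    have hg : ∀ a : S, g a = f a := fun a => by simp [g]
    refine (T.omega_le_iff _ _).2 ⟨g, ?_, ?_⟩
    · rintro _ ⟨a, ha, rfl⟩ _ ⟨b, hb, rfl⟩ hab
      rw [hg, hg] at hab
      rw [hf ha hb hab]
    · intro Q hQ hc
      have hS : ∀ x ∈ Q, x ∈ S := by
        intro x hx
        obtain ⟨a, -, rfl⟩ := hQ hx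
        exact a.2
      have : (Q.subtype (· ∈ S)).card = Q.card := by
        rw [Finset.card_subtype, Finset.filter_true_of_mem hS]
      rw [← this]
      refine hk _ ?_ ?_
      · intro a ha
        have ha' : (a : V) ∈ Q := by simpa using ha
        obtain ⟨b, hb, hab⟩ := hQ ha'
        rwa [← Subtype.ext hab]
      · intro a ha b hb hab
        rw [← hg, ← hg] at hab
        exact hc a (by simpa using ha) b (by simpa using hb) hab

theorem cliqueNumber_eq_omega [Finite V] : T.cliqueNumber = T.omega Set.univ := by
  have h : ∀ k, T.cliqueNumber ≤ k ↔ T.omega Set.univ ≤ k := by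
    intro k
    rw [cliqueNumber_le_iff, omega_le_iff]
    simp [Set.injOn_univ]
  exact le_antisymm ((h _).2 le_rfl) ((h _).1 le_rfl)

end Basic

end Tournament

namespace Tournament

/-! ### Nested cyclic triangles force large clique number -/

section Nested

variable {V : Type u} {W : Type v} (T : Tournament V)

/-- The vertices that form a cyclic triangle with the arc `xy`. -/
def cyc (x y : V) : Set V := {z | T.Adj y z ∧ T.Adj z x}

/-- `N` vertices of `Z` such that, for each arc `xy` between them, there are `N` vertices of
`Z ∩ cyc x y` such that, and so on, `d` levels deep. -/
def Nest (N : ℕ) : ℕ → Set V → Prop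
  | 0, _ => True
  | d + 1, Z => ∃ S : Finset V, ↑S ⊆ Z ∧ S.card = N ∧
      ∀ x ∈ S, ∀ y ∈ S, T.Adj x y → Nest N d (Z ∩ T.cyc x y)

theorem Nest.mono {T : Tournament V} {N d : ℕ} {Z Z' : Set V} (h : T.Nest N d Z) (hZ : Z ⊆ Z') :
    T.Nest N d Z' := by
  induction d generalizing Z Z' with
  | zero => trivial
  | succ d ih =>
    obtain ⟨S, hS, hN, h⟩ := h
    exact ⟨S, hS.trans hZ, hN, fun x hx y hy hxy =>
      ih (h x hx y hy hxy) (Set.inter_subset_inter_left _ hZ)⟩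

/-- A nested structure lives on a bounded number of vertices. -/
theorem exists_nest_finset (N d : ℕ) : ∃ m : ℕ, ∀ (V : Type u) (T : Tournament V) (Z : Set V),
    T.Nest N d Z → ∃ X : Finset V, ↑X ⊆ Z ∧ X.card ≤ m ∧ T.Nest N d X := by
  classical
  induction d with
  | zero => exact ⟨0, fun V T Z _ => ⟨∅, by simp, by simp, trivial⟩⟩
  | succ d ih =>
    obtain ⟨m, hm⟩ := ih
    refine ⟨N + N * N * m, ?_⟩
    rintro V T Z ⟨S, hS, hN, h⟩
    have h' : ∀ p : V × V, ∃ X : Finset V, ↑X ⊆ Z ∩ T.cyc p.1 p.2 ∧ X.card ≤ m ∧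
        (p.1 ∈ S → p.2 ∈ S → T.Adj p.1 p.2 → T.Nest N d X) := by
      intro p
      by_cases hp : p.1 ∈ S ∧ p.2 ∈ S ∧ T.Adj p.1 p.2
      · obtain ⟨X, hX, hXm, hXn⟩ := hm V T _ (h _ hp.1 _ hp.2.1 hp.2.2)
        exact ⟨X, hX, hXm, fun _ _ _ => hXn⟩
      · exact ⟨∅, by simp, by simp, fun h1 h2 h3 => absurd ⟨h1, h2, h3⟩ hp⟩
    choose X hX hXm hXn using h'
    refine ⟨S ∪ (S ×ˢ S).biUnion X, ?_, ?_, S, ?_, hN, ?_⟩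
    · intro v hv
      rcases Finset.mem_union.1 (Finset.mem_coe.1 hv) with hv | hv
      · exact hS hv
      · obtain ⟨p, -, hv⟩ := Finset.mem_biUnion.1 hv
        exact (hX p hv).1
    · refine (Finset.card_union_le _ _).trans (add_le_add hN.le ?_)
      refine (Finset.card_biUnion_le_card_mul _ _ m fun p _ => hXm p).trans ?_
      rw [Finset.card_product, hN]
    · exact fun v hv => Finset.mem_coe.2 (Finset.mem_union_left _ hv)
    · intro x hx y hy hxy
      refine (hXn (x, y) hx hy hxy).mono fun v hv => ⟨?_, (hX _ hv).2⟩
      exact Finset.mem_coe.2 (Finset.mem_union_right _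
        (Finset.mem_biUnion.2 ⟨(x, y), Finset.mem_product.2 ⟨hx, hy⟩, hv⟩))

/-- Vertices `x` below `y`, a clique of size `p.1` with top `x` that is dominated by `Z`, and a
clique of size `p.2` with bottom `y` that dominates `Z`. -/
def Bracketed (f : V → ℕ) (Z₀ Z : Set V) (p : ℕ × ℕ) (x y : V) : Prop :=
  f x < f y ∧
  (∃ R : Finset V, ↑R ⊆ Z₀ ∧ T.BackClique f R ∧ x ∈ R ∧ (∀ r ∈ R, f r ≤ f x) ∧
    T.Complete Z R ∧ R.card = p.1) ∧
  ∃ Q : Finset V, ↑Q ⊆ Z₀ ∧ T.BackClique f Q ∧ y ∈ Q ∧ (∀ q ∈ Q, f y ≤ f q) ∧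
    T.Complete Q Z ∧ Q.card = p.2

theorem Bracketed.mono {T : Tournament V} {f : V → ℕ} {Z₀ Z Z' : Set V} {p : ℕ × ℕ} {x y : V}
    (h : T.Bracketed f Z₀ Z p x y) (hZ : Z' ⊆ Z) : T.Bracketed f Z₀ Z' p x y := by
  obtain ⟨h0, ⟨R, h1, h2, h3, h4, h5, h6⟩, Q, g1, g2, g3, g4, g5, g6⟩ := h
  exact ⟨h0, ⟨R, h1, h2, h3, h4, fun a ha b hb => h5 a (hZ ha) b hb, h6⟩,
    Q, g1, g2, g3, g4, fun a ha b hb => g5 a ha b (hZ hb), g6⟩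

/-- Among many vertices there is a pair with a forward arc that encloses none of the brackets. -/
theorem exists_forward_pair {k : ℕ} {f : V → ℕ} {Z₀ : Set V}
    (hk : ∀ Q : Finset V, ↑Q ⊆ Z₀ → T.BackClique f Q → Q.card ≤ k) {S : Finset V} (hS : ↑S ⊆ Z₀)
    {ι : Type} (Λ : Finset ι) (x y : ι → V) (hxy : ∀ p ∈ Λ, f (x p) < f (y p))
    (hcard : (Λ.card + 1) * k < S.card) :
    ∃ a ∈ S, ∃ b ∈ S, f a < f b ∧ T.Adj a b ∧ ∀ p ∈ Λ, f (x p) < f a ∨ f b < f (y p) := by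
  classical
  -- Vertices are classified by the number of brackets whose upper end lies at or below them. A
  -- class of more than `k` vertices is not a clique, so it contains a forward arc, and no upper end
  -- lies above the start of that arc and at or below its end.
  let g : V → ℕ := fun v => (Λ.filter fun p => f (y p) ≤ f v).card
  obtain ⟨j, -, hj⟩ := Finset.exists_lt_card_fiber_of_mul_lt_card_of_maps_to
    (s := S) (t := Finset.range (Λ.card + 1)) (f := g) (n := k)
    (fun v _ => Finset.mem_range.2 (Nat.lt_succ_of_le (Finset.card_filter_le _ _)))
    (by simpa using hcard)
  set S' := S.filter fun v => g v = j
  have hS' : ↑S' ⊆ Z₀ := fun v hv => hS (Finset.mem_filter.1 (Finset.mem_coe.1 hv)).1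
  have hn : ¬ T.BackClique f S' := fun hc => absurd (hk _ hS' hc) hj.not_ge
  simp only [BackClique] at hn
  push Not at hn
  obtain ⟨a, ha, b, hb, hab, hadj⟩ := hn
  have hne : b ≠ a := fun h => by rw [h] at hab; exact lt_irrefl _ hab
  refine ⟨a, (Finset.mem_filter.1 ha).1, b, (Finset.mem_filter.1 hb).1, hab,
    T.adj_of_not_adj hne hadj, fun p hp => ?_⟩
  by_contra hcon
  push Not at hcon
  have hlt : g a < g b := by
    refine Finset.card_lt_card ⟨fun q hq => ?_, fun hs => ?_⟩
    · simp only [Finset.mem_filter] at hq ⊢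
      exact ⟨hq.1, hq.2.trans hab.le⟩
    · have := hs (Finset.mem_filter.2 ⟨hp, hcon.2⟩)
      have h1 := (Finset.mem_filter.1 this).2
      have h2 := hxy p hp
      omega
  rw [(Finset.mem_filter.1 ha).2, (Finset.mem_filter.1 hb).2] at hlt
  exact lt_irrefl _ hlt

/-- `Λ` records the pairs of clique sizes of the brackets found so far. Choose a forward arc `ab`
that encloses no old bracket, and pass to `Z ∩ cyc a b`, which `b` dominates and which dominates
`a`. Among the old brackets starting below `a`, the largest lower clique is extended by `a`, which
dominates it since `a ∈ Z`; dually `b` extends the largest upper clique among the brackets ending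
above `b`. Every old bracket is beaten in at least one coordinate, so the new pair of sizes is not
in `Λ`. All pairs lie in `[1, k]²`, so each level of nesting uses up one of `k²` values. -/
theorem card_add_depth_le {k N : ℕ} {f : V → ℕ} {Z₀ : Set V}
    (hk : ∀ Q : Finset V, ↑Q ⊆ Z₀ → T.BackClique f Q → Q.card ≤ k) (hN : (k * k + 1) * k < N)
    (d : ℕ) (Z : Set V) (hZ : Z ⊆ Z₀) (hd : T.Nest N d Z) (Λ : Finset (ℕ × ℕ))
    (hΛ : ∀ p ∈ Λ, ∃ x y, T.Bracketed f Z₀ Z p x y) : Λ.card + d ≤ k * k := by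
  classical
  have hΛk : Λ.card ≤ k * k := by
    have : Λ ⊆ Finset.Icc 1 k ×ˢ Finset.Icc 1 k := by
      intro p hp
      obtain ⟨x, y, -, ⟨R, h1, h2, h3, -, -, h6⟩, Q, g1, g2, g3, -, -, g6⟩ := hΛ p hp
      rw [Finset.mem_product, Finset.mem_Icc, Finset.mem_Icc, ← h6, ← g6]
      exact ⟨⟨Finset.card_pos.2 ⟨x, h3⟩, hk _ h1 h2⟩, Finset.card_pos.2 ⟨y, g3⟩, hk _ g1 g2⟩
    simpa using Finset.card_le_card this
  induction d generalizing Z Λ with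
  | zero => simpa using hΛk
  | succ d ih =>
    obtain ⟨S, hS, hSN, hnest⟩ := hd
    have hSpos : 0 < S.card := by omega
    have : Nonempty V := ⟨(Finset.card_pos.1 hSpos).choose⟩
    choose! x y hxy using hΛ
    obtain ⟨a, ha, b, hb, hab, hadj, hnot⟩ := T.exists_forward_pair hk (hS.trans hZ) Λ x y
      (fun p hp => (hxy p hp).1) (by
        rw [hSN]
        exact lt_of_le_of_lt (Nat.mul_le_mul_right _ (by omega)) hN)
    have hR : ∃ R : Finset V, ↑R ⊆ Z₀ ∧ T.BackClique f R ∧ a ∈ R ∧ (∀ r ∈ R, f r ≤ f a) ∧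
        T.Complete (Z ∩ T.cyc a b) R ∧ ∀ p ∈ Λ, f (x p) < f a → p.1 < R.card := by
      rcases (Λ.filter fun p => f (x p) < f a).eq_empty_or_nonempty with he | hne
      · refine ⟨{a}, by simpa using hZ (hS ha), BackClique.singleton T f a, by simp, by simp,
          ?_, ?_⟩
        · intro z hz r hr
          rw [Finset.mem_coe, Finset.mem_singleton] at hr
          rw [hr]
          exact hz.2.2
        · intro p hp hpa
          exact absurd hpa (Finset.filter_eq_empty_iff.1 he hp)
      · obtain ⟨p, hp, hmax⟩ := Finset.exists_max_image _ (fun p => p.1) hne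
        rw [Finset.mem_filter] at hp
        obtain ⟨-, ⟨R, h1, h2, h3, h4, h5, h6⟩, -⟩ := hxy p hp.1
        have hlt : ∀ r ∈ R, ∀ z ∈ ({a} : Finset V), f r < f z := by
          intro r hr z hz
          rw [Finset.mem_singleton.1 hz]
          exact (h4 r hr).trans_lt hp.2
        have hanot : a ∉ R := fun h => lt_irrefl _ (hlt a h a (by simp))
        refine ⟨R ∪ {a}, ?_, h2.union (BackClique.singleton T f a) hlt ?_, by simp, ?_, ?_, ?_⟩
        · intro z hz
          rcases Finset.mem_union.1 (Finset.mem_coe.1 hz) with hz | hz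
          · exact h1 hz
          · rw [Finset.mem_singleton.1 hz]
            exact hZ (hS ha)
        · intro r hr z hz
          rw [Finset.mem_singleton.1 hz]
          exact h5 a (hS ha) r hr
        · intro r hr
          rcases Finset.mem_union.1 hr with hr | hr
          · exact (hlt r hr a (by simp)).le
          · rw [Finset.mem_singleton.1 hr]
        · intro z hz r hr
          rcases Finset.mem_union.1 (Finset.mem_coe.1 hr) with hr | hr
          · exact h5 z hz.1 r hr
          · rw [Finset.mem_singleton.1 hr]
            exact hz.2.2
        · intro q hq hqa
          have := hmax q (Finset.mem_filter.2 ⟨hq, hqa⟩)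
          rw [Finset.card_union_of_disjoint (by simpa using hanot), h6, Finset.card_singleton]
          omega
    have hQ : ∃ Q : Finset V, ↑Q ⊆ Z₀ ∧ T.BackClique f Q ∧ b ∈ Q ∧ (∀ q ∈ Q, f b ≤ f q) ∧
        T.Complete Q (Z ∩ T.cyc a b) ∧ ∀ p ∈ Λ, f b < f (y p) → p.2 < Q.card := by
      rcases (Λ.filter fun p => f b < f (y p)).eq_empty_or_nonempty with he | hne
      · refine ⟨{b}, by simpa using hZ (hS hb), BackClique.singleton T f b, by simp, by simp,
          ?_, ?_⟩
        · intro r hr z hz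
          rw [Finset.mem_coe, Finset.mem_singleton] at hr
          rw [hr]
          exact hz.2.1
        · intro p hp hpa
          exact absurd hpa (Finset.filter_eq_empty_iff.1 he hp)
      · obtain ⟨p, hp, hmax⟩ := Finset.exists_max_image _ (fun p => p.2) hne
        rw [Finset.mem_filter] at hp
        obtain ⟨-, -, Q, h1, h2, h3, h4, h5, h6⟩ := hxy p hp.1
        have hlt : ∀ z ∈ ({b} : Finset V), ∀ r ∈ Q, f z < f r := by
          intro z hz r hr
          rw [Finset.mem_singleton.1 hz]
          exact hp.2.trans_le (h4 r hr)
        have hbnot : b ∉ Q := fun h => lt_irrefl _ (hlt b (by simp) b h)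
        refine ⟨{b} ∪ Q, ?_, (BackClique.singleton T f b).union h2 hlt ?_, by simp, ?_, ?_, ?_⟩
        · intro z hz
          rcases Finset.mem_union.1 (Finset.mem_coe.1 hz) with hz | hz
          · rw [Finset.mem_singleton.1 hz]
            exact hZ (hS hb)
          · exact h1 hz
        · intro z hz r hr
          rw [Finset.mem_singleton.1 hz]
          exact h5 r hr b (hS hb)
        · intro r hr
          rcases Finset.mem_union.1 hr with hr | hr
          · rw [Finset.mem_singleton.1 hr]
          · exact (hlt b (by simp) r hr).le
        · intro r hr z hz
          rcases Finset.mem_union.1 (Finset.mem_coe.1 hr) with hr | hr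
          · rw [Finset.mem_singleton.1 hr]
            exact hz.2.1
          · exact h5 r hr z hz.1
        · intro q hq hqa
          have := hmax q (Finset.mem_filter.2 ⟨hq, hqa⟩)
          rw [Finset.card_union_of_disjoint (by simpa using hbnot), h6, Finset.card_singleton]
          omega
    obtain ⟨R, h1, h2, h3, h4, h5, h6⟩ := hR
    obtain ⟨Q, g1, g2, g3, g4, g5, g6⟩ := hQ
    have hnew : (R.card, Q.card) ∉ Λ := by
      intro hp
      rcases hnot _ hp with h | h
      · exact lt_irrefl _ (h6 _ hp h)
      · exact lt_irrefl _ (g6 _ hp h)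
    have hΛ' : ∀ p ∈ insert (R.card, Q.card) Λ, ∃ x y, T.Bracketed f Z₀ (Z ∩ T.cyc a b) p x y := by
      intro p hp
      rcases Finset.mem_insert.1 hp with rfl | hp
      · exact ⟨a, b, hab, ⟨R, h1, h2, h3, h4, h5, rfl⟩, Q, g1, g2, g3, g4, g5, rfl⟩
      · exact ⟨x p, y p, (hxy p hp).mono Set.inter_subset_left⟩
    have := ih (Z ∩ T.cyc a b) (Set.inter_subset_left.trans hZ) (hnest a ha b hb hadj)
      (insert (R.card, Q.card) Λ) hΛ' (by
        have : insert (R.card, Q.card) Λ ⊆ Finset.Icc 1 k ×ˢ Finset.Icc 1 k := by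
          intro p hp
          obtain ⟨x, y, -, ⟨R, h1, h2, h3, -, -, h6⟩, Q, g1, g2, g3, -, -, g6⟩ := hΛ' p hp
          rw [Finset.mem_product, Finset.mem_Icc, Finset.mem_Icc, ← h6, ← g6]
          exact ⟨⟨Finset.card_pos.2 ⟨x, h3⟩, hk _ h1 h2⟩, Finset.card_pos.2 ⟨y, g3⟩, hk _ g1 g2⟩
        simpa using Finset.card_le_card this)
    rw [Finset.card_insert_of_notMem hnew] at this
    omega

/-- Deeply nested structures have large clique number. -/
theorem lt_omega_of_nest [Finite V] {k N : ℕ} (hN : (k * k + 1) * k < N) {Z : Set V}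
    (h : T.Nest N (k * k + 1) Z) : k < T.omega Z := by
  by_contra hcon
  obtain ⟨f, hf, hk⟩ := (T.omega_le_iff Z k).1 (not_lt.1 hcon)
  have := T.card_add_depth_le hk hN _ Z subset_rfl h ∅ (by simp)
  simp at this

end Nested

/-! ### The clique number of `D_n` is unbounded -/

section GrowthD

variable {V : Type u} (T : Tournament V)

instance finite_DVert : ∀ n, Finite (DVert n)
  | 0 => inferInstanceAs (Finite Empty)
  | n + 1 => by
    have := finite_DVert n
    exact inferInstanceAs (Finite (DVert n ⊕ DVert n ⊕ Unit))

/-- There is a homomorphic copy of `H` inside `X`. -/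
def HasCopy {W : Type v} (H : Tournament W) (X : Set V) : Prop :=
  ∃ φ : W → V, (∀ a, φ a ∈ X) ∧ ∀ a b, H.Adj a b → T.Adj (φ a) (φ b)

theorem HasCopy.mono {T : Tournament V} {W : Type v} {H : Tournament W} {X Y : Set V}
    (h : T.HasCopy H X) (hXY : X ⊆ Y) : T.HasCopy H Y := by
  obtain ⟨φ, h1, h2⟩ := h
  exact ⟨φ, fun a => hXY (h1 a), h2⟩

theorem hasCopy_D_succ_iff {n : ℕ} {Z : Set V} :
    T.HasCopy (D (n + 1)) Z ↔ ∃ v ∈ Z, ∃ X Y : Set V, X ⊆ Z ∧ Y ⊆ Z ∧ T.HasCopy (D n) X ∧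
      T.HasCopy (D n) Y ∧ T.Complete X Y ∧ (∀ x ∈ X, T.Adj v x) ∧ ∀ y ∈ Y, T.Adj y v := by
  constructor
  · rintro ⟨φ, h1, h2⟩
    refine ⟨φ (.inr (.inr ())), h1 _, Set.range fun a => φ (.inl a),
      Set.range fun a => φ (.inr (.inl a)), ?_, ?_, ?_, ?_, ?_, ?_, ?_⟩
    · rintro _ ⟨a, rfl⟩
      exact h1 _
    · rintro _ ⟨a, rfl⟩
      exact h1 _
    · exact ⟨fun a => φ (.inl a), fun a => ⟨a, rfl⟩, fun a b h => h2 _ _ h⟩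
    · exact ⟨fun a => φ (.inr (.inl a)), fun a => ⟨a, rfl⟩, fun a b h => h2 _ _ h⟩
    · rintro _ ⟨a, rfl⟩ _ ⟨b, rfl⟩
      exact h2 _ _ trivial
    · rintro _ ⟨a, rfl⟩
      exact h2 _ _ trivial
    · rintro _ ⟨a, rfl⟩
      exact h2 _ _ trivial
  · rintro ⟨v, hv, X, Y, hX, hY, ⟨φ, h1, h2⟩, ⟨ψ, g1, g2⟩, hXY, hvX, hYv⟩
    refine ⟨Sum.elim φ (Sum.elim ψ fun _ => v), ?_, ?_⟩
    · rintro (a | a | a)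
      · exact hX (h1 a)
      · exact hY (g1 a)
      · exact hv
    · rintro (a | a | a) (b | b | b) h
      · exact h2 _ _ h
      · exact hXY _ (h1 a) _ (g1 b)
      · exact h.elim
      · exact h.elim
      · exact g2 _ _ h
      · exact hYv _ (g1 a)
      · exact hvX _ (h1 b)
      · exact h.elim
      · exact h.elim

theorem hasCopy_D_zero {Z : Set V} : T.HasCopy (D 0) Z :=
  ⟨fun a => a.elim, fun a => a.elim, fun a => a.elim⟩

theorem HasCopy.D_le {T : Tournament V} {n m : ℕ} {Z : Set V} (h : T.HasCopy (D n) Z)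
    (hm : m ≤ n) : T.HasCopy (D m) Z := by
  induction n with
  | zero => rwa [Nat.le_zero.1 hm]
  | succ n ih =>
    rcases Nat.lt_or_ge n m with h' | h'
    · rwa [show m = n + 1 by omega]
    · obtain ⟨v, hv, X, Y, hX, -, hDX, -⟩ := T.hasCopy_D_succ_iff.1 h
      exact ih (hDX.mono hX) h'

/-- The set consists of the apices met on descending `N` times into the first copy. An arc from an
apex `v` to a later apex `x` has the whole second copy in `cyc v x`, because that copy is dominated
by `x` and dominates `v`. -/
theorem HasCopy.exists_heavy_set {T : Tournament V} {a N : ℕ} {Z : Set V}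
    (h : T.HasCopy (D (a + N)) Z) : ∃ S : Finset V, ↑S ⊆ Z ∧ S.card = N ∧
      ∀ x ∈ S, ∀ y ∈ S, T.Adj x y → T.HasCopy (D a) (Z ∩ T.cyc x y) := by
  classical
  induction N generalizing Z with
  | zero => exact ⟨∅, by simp, rfl, by simp⟩
  | succ N ih =>
    obtain ⟨v, hv, X, Y, hX, hY, hDX, hDY, hXY, hvX, hYv⟩ := T.hasCopy_D_succ_iff.1 h
    obtain ⟨S, hS, hN, hc⟩ := ih hDX
    have hvS : v ∉ S := fun hvS => T.irrefl v (hvX v (hS hvS))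
    refine ⟨insert v S, ?_, by rw [Finset.card_insert_of_notMem hvS, hN], ?_⟩
    · intro z hz
      rcases Finset.mem_insert.1 (Finset.mem_coe.1 hz) with rfl | hz
      · exact hv
      · exact hX (hS hz)
    · intro x hx y hy hxy
      rcases Finset.mem_insert.1 hx with rfl | hxS <;>
        rcases Finset.mem_insert.1 hy with rfl | hyS
      · exact absurd hxy (T.irrefl _)
      · exact (hDY.D_le (Nat.le_add_right _ _)).mono fun z hz => ⟨hY hz, hXY _ (hS hyS) _ hz, hYv _ hz⟩
      · exact absurd hxy (T.asymm _ _ (hvX _ (hS hxS)))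
      · exact (hc x hxS y hyS hxy).mono (Set.inter_subset_inter_left _ hX)

theorem HasCopy.nest {T : Tournament V} (N d : ℕ) {Z : Set V} (h : T.HasCopy (D (d * N)) Z) :
    T.Nest N d Z := by
  induction d generalizing Z with
  | zero => trivial
  | succ d ih =>
    rw [add_mul, one_mul] at h
    obtain ⟨S, hS, hN, hc⟩ := h.exists_heavy_set
    exact ⟨S, hS, hN, fun x hx y hy hxy => ih (hc x hx y hy hxy)⟩

/-- The clique number of `D_n` tends to infinity. -/
theorem exists_lt_omega_of_hasCopy_D (k : ℕ) : ∃ n : ℕ, ∀ (V : Type u) [Finite V]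
    (T : Tournament V) (Z : Set V), T.HasCopy (D n) Z → k < T.omega Z :=
  ⟨(k * k + 1) * ((k * k + 1) * k + 1), fun _ _ T _ h =>
    T.lt_omega_of_nest (Nat.lt_succ_self _) h.nest⟩

end GrowthD

end Tournament

namespace Tournament

/-! ### Large domination number forces small sets of large clique number -/

section Domination

variable {V : Type u} (T : Tournament V)

/-- The vertices that dominate the whole of `F`. -/
def above (F : Finset V) : Set V := {v | ∀ u ∈ F, T.Adj v u}

/-- No set of fewer than `K` vertices of `Y` dominates `Y`. -/
def Undom (Y : Set V) (K : ℕ) : Prop :=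
  ∀ D : Finset V, ↑D ⊆ Y → D.card < K → ∃ v ∈ Y, ∀ d ∈ D, T.Adj v d

/-- `Y` has at most `l` vertices that induce a subtournament with clique number at least `k`. -/
def HasCluster (k l : ℕ) (Y : Set V) : Prop :=
  ∃ X : Finset V, ↑X ⊆ Y ∧ X.card ≤ l ∧ k ≤ T.omega X

theorem HasCluster.mono {T : Tournament V} {k l l' : ℕ} {Y Y' : Set V} (h : T.HasCluster k l Y)
    (hY : Y ⊆ Y') (hl : l ≤ l') : T.HasCluster k l' Y' := by
  obtain ⟨X, h1, h2, h3⟩ := h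
  exact ⟨X, h1.trans hY, h2.trans hl, h3⟩

theorem Undom.mono {T : Tournament V} {Y : Set V} {K K' : ℕ} (h : T.Undom Y K) (hK : K' ≤ K) :
    T.Undom Y K' :=
  fun D hD hc => h D hD (hc.trans_le hK)

/-- A small dominating set of `Y ∩ T.above Z`, together with `Z`, would dominate `Y`. -/
theorem Undom.inter_above {T : Tournament V} {Y : Set V} {K K' : ℕ} (h : T.Undom Y K')
    {Z : Finset V} (hZ : ↑Z ⊆ Y) (hK : Z.card + K ≤ K') : T.Undom (Y ∩ T.above Z) K := by
  classical
  intro D hD hc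
  obtain ⟨v, hv, hvD⟩ := h (D ∪ Z) (by
    rw [Finset.coe_union]
    exact Set.union_subset (hD.trans Set.inter_subset_left) hZ)
    (by have := Finset.card_union_le D Z; omega)
  exact ⟨v, ⟨hv, fun u hu => hvD u (Finset.mem_union_right _ hu)⟩,
    fun d hd => hvD d (Finset.mem_union_left _ hd)⟩

/-- The number of vertices of `Q` that come before `z`. -/
def before (f : V → ℕ) (Q : Finset V) (z : V) : ℕ := (Q.filter fun q => f q < f z).card

theorem before_mono (f : V → ℕ) (Q : Finset V) {y z : V} (h : f y ≤ f z) :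
    before f Q y ≤ before f Q z := by
  refine Finset.card_le_card fun q hq => ?_
  simp only [Finset.mem_filter] at hq ⊢
  exact ⟨hq.1, hq.2.trans_le h⟩

variable {T} in
-- The vertices of `Q` below `z` and those of `P` not below `z` form a clique together. It has at
-- most `k = |P|` vertices, so `Q` has no more vertices below `z` than `P` has.
theorem before_le_before {k : ℕ} {f : V → ℕ} {Z₀ : Set V}
    (hk : ∀ Q : Finset V, ↑Q ⊆ Z₀ → T.BackClique f Q → Q.card ≤ k) {Q P : Finset V}
    (hQ : ↑Q ⊆ Z₀) (hP : ↑P ⊆ Z₀) (hQc : T.BackClique f Q) (hPc : T.BackClique f P)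
    (hPk : P.card = k) (hPQ : T.Complete P Q) (z : V) : before f Q z ≤ before f P z := by
  classical
  have hlt : ∀ x ∈ Q.filter (fun q => f q < f z), ∀ y ∈ P.filter (fun p => ¬ f p < f z),
      f x < f y := by
    intro x hx y hy
    have h1 := (Finset.mem_filter.1 hx).2
    have h2 := (Finset.mem_filter.1 hy).2
    omega
  have hc := (hQc.mono (Finset.filter_subset (fun q => f q < f z) Q)).union
    (hPc.mono (Finset.filter_subset (fun p => ¬ f p < f z) P)) hlt
    (fun x hx y hy => hPQ _ (Finset.mem_filter.1 hy).1 _ (Finset.mem_filter.1 hx).1)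
  have hcard := hk _ (by
    rw [Finset.coe_union]
    exact Set.union_subset (fun x hx => hQ (Finset.mem_filter.1 (Finset.mem_coe.1 hx)).1)
      fun x hx => hP (Finset.mem_filter.1 (Finset.mem_coe.1 hx)).1) hc
  rw [Finset.card_union_of_disjoint (Finset.disjoint_left.2 fun x hx hy =>
    lt_irrefl _ (hlt x hx x hy))] at hcard
  have := Finset.card_filter_add_card_filter_not (s := P) (fun p => f p < f z)
  unfold before
  omega

variable {T} in
-- As in `before_le_before`, but now `z` itself fits between the two pieces of the clique, which
-- gains one vertex.
theorem before_lt_before {k : ℕ} {f : V → ℕ} {Z₀ : Set V} (hf : Set.InjOn f Z₀)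
    (hk : ∀ Q : Finset V, ↑Q ⊆ Z₀ → T.BackClique f Q → Q.card ≤ k) {Q P : Finset V} {z : V}
    (hQ : ↑Q ⊆ Z₀) (hP : ↑P ⊆ Z₀) (hz : z ∈ Z₀) (hQc : T.BackClique f Q)
    (hPc : T.BackClique f P) (hPk : P.card = k) (hPQ : T.Complete P Q)
    (hPz : ∀ p ∈ P, T.Adj p z) (hzQ : ∀ q ∈ Q, T.Adj z q) : before f Q z < before f P z := by
  classical
  have hlt1 : ∀ x ∈ Q.filter (fun q => f q < f z), ∀ y ∈ ({z} : Finset V), f x < f y := by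
    intro x hx y hy
    rw [Finset.mem_singleton.1 hy]
    exact (Finset.mem_filter.1 hx).2
  have hc1 := (hQc.mono (Finset.filter_subset (fun q => f q < f z) Q)).union
    (BackClique.singleton T f z) hlt1 (fun x hx y hy => by
      rw [Finset.mem_singleton.1 hy]
      exact hzQ _ (Finset.mem_filter.1 hx).1)
  have hlt2 : ∀ x ∈ Q.filter (fun q => f q < f z) ∪ {z}, ∀ y ∈ P.filter (fun p => ¬ f p < f z),
      f x < f y := by
    intro x hx y hy
    have h2 := (Finset.mem_filter.1 hy).2
    have h3 : f y ≠ f z := fun h =>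
      T.ne_of_adj (hPz y (Finset.mem_filter.1 hy).1) (hf (hP (Finset.mem_filter.1 hy).1) hz h)
    rcases Finset.mem_union.1 hx with hx | hx
    · have h1 := (Finset.mem_filter.1 hx).2
      omega
    · rw [Finset.mem_singleton.1 hx]
      omega
  have hc2 := hc1.union (hPc.mono (Finset.filter_subset (fun p => ¬ f p < f z) P)) hlt2
    (fun x hx y hy => by
      have hy := (Finset.mem_filter.1 hy).1
      rcases Finset.mem_union.1 hx with hx | hx
      · exact hPQ _ hy _ (Finset.mem_filter.1 hx).1
      · rw [Finset.mem_singleton.1 hx]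
        exact hPz y hy)
  have hcard := hk _ (by
    rw [Finset.coe_union, Finset.coe_union, Finset.coe_singleton]
    refine Set.union_subset (Set.union_subset (fun x hx => ?_) (by simpa using hz)) fun x hx => ?_
    · exact hQ (Finset.mem_filter.1 (Finset.mem_coe.1 hx)).1
    · exact hP (Finset.mem_filter.1 (Finset.mem_coe.1 hx)).1) hc2
  rw [Finset.card_union_of_disjoint (Finset.disjoint_left.2 fun x hx hy =>
      lt_irrefl _ (hlt2 x hx x hy)),
    Finset.card_union_of_disjoint (Finset.disjoint_left.2 fun x hx hy =>
      lt_irrefl _ (hlt1 x hx x hy)), Finset.card_singleton] at hcard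
  have := Finset.card_filter_add_card_filter_not (s := P) (fun p => f p < f z)
  unfold before
  omega

/-- A sequence of sets with clique number at least `k`, alternately dominating and dominated
by `z`, each of them dominating the previous one. The last set is `G`. -/
def Ladder (k : ℕ) (z : V) : ℕ → Finset V → Finset V → Prop
  | 0, G, M => G ⊆ M ∧ k ≤ T.omega G
  | r + 1, G, M => ∃ G' X : Finset V, Ladder k z r G' M ∧ X ⊆ M ∧ k ≤ T.omega X ∧
      T.Complete X G' ∧ (∀ x ∈ X, T.Adj z x) ∧ G ⊆ M ∧ k ≤ T.omega G ∧
      T.Complete G X ∧ ∀ g ∈ G, T.Adj g z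

theorem Ladder.mono {T : Tournament V} {k r : ℕ} {z : V} {G M M' : Finset V}
    (h : T.Ladder k z r G M) (hM : M ⊆ M') : T.Ladder k z r G M' := by
  induction r generalizing G with
  | zero => exact ⟨h.1.trans hM, h.2⟩
  | succ r ih =>
    obtain ⟨G', X, h1, h2, h3, h4, h5, h6, h7⟩ := h
    exact ⟨G', X, ih h1, h2.trans hM, h3, h4, h5, h6.trans hM, h7⟩

theorem Ladder.subset {T : Tournament V} {k r : ℕ} {z : V} {G M : Finset V}
    (h : T.Ladder k z r G M) : G ⊆ M ∧ k ≤ T.omega G := by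
  cases r with
  | zero => exact h
  | succ r =>
    obtain ⟨G', X, h1, h2, h3, h4, h5, h6, h7, h8⟩ := h
    exact ⟨h6, h7⟩

/-- For `k`-cliques taken from the successive sets, the number of vertices below `z` never drops,
and it rises on each step from a set dominated by `z` to one dominating `z`. Since it cannot exceed
`k`, a ladder with `k + 1` rungs is impossible under a ranking without larger cliques. -/
theorem Ladder.le_before [Finite V] {T : Tournament V} {k r : ℕ} {z : V} {G M : Finset V}
    (h : T.Ladder k z r G M) (hz : z ∈ M) {f : V → ℕ} (hf : Set.InjOn f M)
    (hk : ∀ Q : Finset V, ↑Q ⊆ (↑M : Set V) → T.BackClique f Q → Q.card ≤ k) {Q : Finset V}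
    (hQ : Q ⊆ G) (hQc : T.BackClique f Q) (hQk : Q.card = k) : r ≤ before f Q z := by
  induction r generalizing G Q with
  | zero => exact Nat.zero_le _
  | succ r ih =>
    obtain ⟨G', X, h1, h2, h3, h4, h5, h6, h7, h8, h9⟩ := h
    have hX : (↑X : Set V) ⊆ ↑M := Finset.coe_subset.2 h2
    have hG : (↑G : Set V) ⊆ ↑M := Finset.coe_subset.2 h6
    have hG' : (↑G' : Set V) ⊆ ↑M := Finset.coe_subset.2 h1.subset.1
    obtain ⟨R, hR, hRc, hRk⟩ := T.exists_backClique_of_le_omega h1.subset.2 (hf.mono hG')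
    obtain ⟨P, hP, hPc, hPk⟩ := T.exists_backClique_of_le_omega h3 (hf.mono hX)
    have e1 := ih h1 (Finset.coe_subset.1 hR) hRc hRk
    have e2 := before_le_before hk (hR.trans hG') (hP.trans hX) hRc hPc hPk
      (fun x hx y hy => h4 x (hP hx) y (hR hy)) z
    have e3 := before_lt_before hf hk (hP.trans hX) ((Finset.coe_subset.2 hQ).trans hG)
      (Finset.mem_coe.2 hz) hPc hQc hQk (fun x hx y hy => h8 x (hQ hx) y (hP hy))
      (fun q hq => h9 q (hQ hq)) (fun p hp => h5 p (hP hp))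
    omega

theorem Ladder.lt_omega [Finite V] {T : Tournament V} {k : ℕ} {z : V} {G M : Finset V}
    (h : T.Ladder k z (k + 1) G M) (hz : z ∈ M) : k < T.omega M := by
  by_contra hcon
  obtain ⟨f, hf, hk⟩ := (T.omega_le_iff M k).1 (not_lt.1 hcon)
  obtain ⟨Q, hQ, hQc, hQk⟩ := T.exists_backClique_of_le_omega h.subset.2
    (hf.mono (Finset.coe_subset.2 h.subset.1))
  have h1 := h.le_before hz hf hk (Finset.coe_subset.1 hQ) hQc hQk
  have h2 : before f Q z ≤ Q.card := Finset.card_filter_le _ _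
  omega

/-- All ladders, one for each `z ∈ Z`, are built simultaneously and share the sets `G`. The next `G`
dominates everything chosen so far and exists because `Y` has large domination number. A ladder
stops growing only when the out-neighbours of `z` above `F` contain no further cluster. -/
theorem exists_ladder (k K l N r : ℕ) : ∃ K' m : ℕ, ∀ (V : Type u) [Finite V] (T : Tournament V),
    (∀ Y, T.Undom Y K → T.HasCluster k l Y) → ∀ Y, T.Undom Y K' → ∀ Z : Finset V, ↑Z ⊆ Y →
    Z.card ≤ N → ∃ G F M : Finset V, G ⊆ F ∧ F ⊆ M ∧ ↑M ⊆ Y ∧ Z ⊆ M ∧ F.card ≤ (r + 1) * l ∧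
      M.card ≤ m ∧ k ≤ T.omega G ∧ T.Complete G Z ∧
      ∀ z ∈ Z, T.Ladder k z r G M ∨
        ¬ T.HasCluster k l (Y ∩ {x | T.Adj z x} ∩ T.above F) := by
  classical
  induction r with
  | zero =>
    refine ⟨N + K, N + l, ?_⟩
    intro V _ T hcl Y hY Z hZ hN
    obtain ⟨G, hG, hGl, hGk⟩ := hcl _ (hY.inter_above hZ (Nat.add_le_add_right hN K))
    refine ⟨G, G, Z ∪ G, subset_rfl, Finset.subset_union_right, ?_, Finset.subset_union_left,
      by simpa using hGl, (Finset.card_union_le _ _).trans (add_le_add hN hGl), hGk,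
      fun x hx y hy => (hG hx).2 y hy, fun z _ => Or.inl ⟨Finset.subset_union_right, hGk⟩⟩
    rw [Finset.coe_union]
    exact Set.union_subset hZ (hG.trans Set.inter_subset_left)
  | succ r ih =>
    obtain ⟨K', m, ih⟩ := ih
    refine ⟨max K' (m + N * l + K), m + N * l + l, ?_⟩
    intro V _ T hcl Y hY Z hZ hN
    obtain ⟨G', F', M', hGF, hFM, hM, hZM, hFl, hMm, hGk, hGZ, halt⟩ :=
      ih V T hcl Y (hY.mono (le_max_left _ _)) Z hZ hN
    have hX : ∀ z, ∃ X : Finset V, ↑X ⊆ Y ∩ {x | T.Adj z x} ∩ T.above F' ∧ X.card ≤ l ∧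
        (T.HasCluster k l (Y ∩ {x | T.Adj z x} ∩ T.above F') → k ≤ T.omega X) := by
      intro z
      by_cases h : T.HasCluster k l (Y ∩ {x | T.Adj z x} ∩ T.above F')
      · obtain ⟨X, h1, h2, h3⟩ := h
        exact ⟨X, h1, h2, fun _ => h3⟩
      · exact ⟨∅, by simp, by simp, fun h' => absurd h' h⟩
    choose X hX hXl hXk using hX
    set B := M' ∪ Z.biUnion X with hB
    have hBY : ↑B ⊆ Y := by
      intro v hv
      rcases Finset.mem_union.1 (Finset.mem_coe.1 hv) with hv | hv
      · exact hM hv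
      · obtain ⟨z, -, hv⟩ := Finset.mem_biUnion.1 hv
        exact (hX z hv).1.1
    have hBm : B.card ≤ m + N * l := by
      refine (Finset.card_union_le _ _).trans (add_le_add hMm ?_)
      exact (Finset.card_biUnion_le_card_mul _ _ l fun z _ => hXl z).trans
        (Nat.mul_le_mul_right _ hN)
    obtain ⟨G, hG, hGl, hGk'⟩ := hcl _ ((hY.mono (le_max_right _ _)).inter_above hBY
      (Nat.add_le_add_right hBm K))
    have hGB : T.Complete G B := fun x hx y hy => (hG hx).2 y hy
    refine ⟨G, F' ∪ G, B ∪ G, Finset.subset_union_right, ?_, ?_, ?_, ?_, ?_, hGk', ?_, ?_⟩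
    · exact Finset.union_subset_union (hFM.trans Finset.subset_union_left) subset_rfl
    · rw [Finset.coe_union]
      exact Set.union_subset hBY (hG.trans Set.inter_subset_left)
    · exact (hZM.trans Finset.subset_union_left).trans Finset.subset_union_left
    · refine (Finset.card_union_le _ _).trans ?_
      rw [add_mul (r + 1), one_mul]
      exact add_le_add hFl hGl
    · exact (Finset.card_union_le _ _).trans (add_le_add hBm hGl)
    · exact fun x hx y hy => hGB x hx y (Finset.mem_union_left _ (hZM hy))
    · intro z hz
      by_cases h : T.HasCluster k l (Y ∩ {x | T.Adj z x} ∩ T.above F')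
      · left
        have hXB : X z ⊆ B := fun x hx =>
          Finset.mem_union_right _ (Finset.mem_biUnion.2 ⟨z, hz, hx⟩)
        refine ⟨G', X z, ((halt z hz).resolve_right (not_not.2 h)).mono
          (Finset.subset_union_left.trans Finset.subset_union_left),
          hXB.trans Finset.subset_union_left, hXk z h, ?_, ?_, Finset.subset_union_right, hGk',
          ?_, ?_⟩
        · exact fun x hx y hy => (hX z hx).2 y (hGF hy)
        · exact fun x hx => (hX z hx).1.2
        · exact fun x hx y hy => hGB x hx y (hXB hy)
        · exact fun g hg => hGB g hg z (Finset.mem_union_left _ (hZM hz))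
      · right
        -- A ladder that has stopped stays so, because enlarging `F` shrinks `T.above F`.
        refine fun h' => h (h'.mono (Set.inter_subset_inter_right _ fun x hx u hu => ?_) le_rfl)
        exact hx u (Finset.mem_union_left _ hu)

/-- A ladder with `k + 1` rungs would be a bounded set of clique number above `k`, so every ladder
stops. The bound on `F` does not involve `N`, which is what makes the final exchange argument work.
-/
theorem exists_blocking (k K l N : ℕ) : ∃ K' m : ℕ, ∀ (V : Type u) [Finite V] (T : Tournament V),
    (∀ Y, T.Undom Y K → T.HasCluster k l Y) → ∀ Y, T.Undom Y K' → ¬ T.HasCluster (k + 1) m Y →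
    ∀ Z : Finset V, ↑Z ⊆ Y → Z.card ≤ N → ∃ G F : Finset V, G ⊆ F ∧ ↑F ⊆ Y ∧
      F.card ≤ (k + 2) * l ∧ k ≤ T.omega G ∧ T.Complete G Z ∧
      ∀ z ∈ Z, ¬ T.HasCluster k l (Y ∩ {x | T.Adj z x} ∩ T.above F) := by
  obtain ⟨K', m, h⟩ := exists_ladder.{u} k K l N (k + 1)
  refine ⟨K', m, fun V _ T hcl Y hY hno Z hZ hN => ?_⟩
  obtain ⟨G, F, M, hGF, hFM, hM, hZM, hFl, hMm, hGk, hGZ, halt⟩ := h V T hcl Y hY Z hZ hN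
  refine ⟨G, F, hGF, (Finset.coe_subset.2 hFM).trans hM, hFl, hGk, hGZ, fun z hz => ?_⟩
  exact (halt z hz).resolve_left fun h' => hno ⟨M, hM, hMm, h'.lt_omega (hZM hz)⟩

/-- A transitive sequence of vertices (the elements of `S`), any two consecutive ones separated by
a set with clique number at least `k`; the sets dominate everything before them and are dominated
by the following vertex. The last set is `G`. -/
def Chain (k : ℕ) : ℕ → Finset V → Finset V → Finset V → Prop
  | 0, S, G, M => S = ∅ ∧ G ⊆ M ∧ k ≤ T.omega G
  | j + 1, S, G, M => ∃ (S' G' : Finset V) (z : V) (hz : z ∉ S'), Chain k j S' G' M ∧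
      S = Finset.cons z S' hz ∧ z ∈ M ∧ G ⊆ M ∧ k ≤ T.omega G ∧ (∀ g ∈ G', T.Adj z g) ∧
      (∀ g ∈ G, T.Adj g z) ∧ T.Complete G G' ∧ ∀ s ∈ S', T.Adj s z

theorem Chain.mono {T : Tournament V} {k j : ℕ} {S G M M' : Finset V} (h : T.Chain k j S G M)
    (hM : M ⊆ M') : T.Chain k j S G M' := by
  induction j generalizing S G with
  | zero => exact ⟨h.1, h.2.1.trans hM, h.2.2⟩
  | succ j ih =>
    obtain ⟨S', G', z, hz, h1, h2, h3, h4, h5⟩ := h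
    exact ⟨S', G', z, hz, ih h1, h2, hM h3, h4.trans hM, h5⟩

theorem Chain.subset {T : Tournament V} {k j : ℕ} {S G M : Finset V} (h : T.Chain k j S G M) :
    S ⊆ M ∧ S.card = j ∧ G ⊆ M ∧ k ≤ T.omega G := by
  induction j generalizing S G with
  | zero => exact ⟨by simp [h.1], by simp [h.1], h.2⟩
  | succ j ih =>
    obtain ⟨S', G', z, hz, h1, rfl, h3, h4, h5, -⟩ := h
    refine ⟨?_, by rw [Finset.card_cons, (ih h1).2.1], h4, h5⟩
    intro x hx
    rcases Finset.mem_cons.1 hx with rfl | hx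
    · exact h3
    · exact (ih h1).1 hx

/-- A vertex `z` receives one more than the number of vertices below it in a `k`-clique of the set
preceding it. An earlier `s` has at least `col s` vertices of that clique below it, so equal colours
force `s` above `z`; as the chain has the arc `sz`, this is a backedge. Thus each colour class is a
clique. -/
theorem Chain.exists_coloring [Finite V] {T : Tournament V} {k j : ℕ} {S G M : Finset V}
    (h : T.Chain k j S G M) {f : V → ℕ} (hf : Set.InjOn f M)
    (hk : ∀ Q : Finset V, ↑Q ⊆ (↑M : Set V) → T.BackClique f Q → Q.card ≤ k) :
    ∃ col : V → ℕ, (∀ s ∈ S, 1 ≤ col s ∧ ∀ Q : Finset V, Q ⊆ G → T.BackClique f Q → Q.card = k →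
        col s ≤ before f Q s) ∧
      ∀ s ∈ S, ∀ t ∈ S, col s = col t → f s < f t → T.Adj t s := by
  classical
  induction j generalizing S G with
  | zero => exact ⟨fun _ => 0, by simp [h.1], by simp [h.1]⟩
  | succ j ih =>
    obtain ⟨S', G', z, hz, h1, rfl, h3, h4, h5, h6, h7, h8, h9⟩ := h
    obtain ⟨col, hcol, hmono⟩ := ih h1
    have hG : (↑G : Set V) ⊆ ↑M := Finset.coe_subset.2 h4
    have hG' : (↑G' : Set V) ⊆ ↑M := Finset.coe_subset.2 h1.subset.2.2.1
    obtain ⟨R, hR, hRc, hRk⟩ := T.exists_backClique_of_le_omega h1.subset.2.2.2 (hf.mono hG')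
    have key : ∀ s ∈ S', before f R z + 1 = col s → f z < f s := by
      intro s hs hcs
      by_contra hcon
      have e1 := (hcol s hs).2 R (Finset.coe_subset.1 hR) hRc hRk
      have e2 := before_mono f R (not_lt.1 hcon)
      omega
    refine ⟨Function.update col z (before f R z + 1), ?_, ?_⟩
    · intro s hs
      rcases Finset.mem_cons.1 hs with rfl | hs
      · rw [Function.update_self]
        refine ⟨by omega, fun Q hQ hQc hQk => ?_⟩
        exact before_lt_before hf hk (hR.trans hG') ((Finset.coe_subset.2 hQ).trans hG)
          (Finset.mem_coe.2 h3) hRc hQc hQk (fun x hx y hy => h8 x (hQ hx) y (hR hy))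
          (fun q hq => h7 q (hQ hq)) (fun q hq => h6 q (hR hq))
      · have hne : s ≠ z := fun h => hz (h ▸ hs)
        rw [Function.update_of_ne hne]
        refine ⟨(hcol s hs).1, fun Q hQ hQc hQk => ?_⟩
        refine ((hcol s hs).2 R (Finset.coe_subset.1 hR) hRc hRk).trans ?_
        exact before_le_before hk (hR.trans hG') ((Finset.coe_subset.2 hQ).trans hG) hRc hQc hQk
          (fun x hx y hy => h8 x (hQ hx) y (hR hy)) s
    · intro s hs t ht hst hlt
      rcases Finset.mem_cons.1 hs with hs' | hs' <;> rcases Finset.mem_cons.1 ht with ht' | ht'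
      · rw [hs', ht'] at hlt
        exact absurd hlt (lt_irrefl _)
      · rw [hs']
        exact h9 t ht'
      · have hne : s ≠ z := fun h => hz (h ▸ hs')
        rw [ht', Function.update_self, Function.update_of_ne hne] at hst
        rw [ht'] at hlt
        exact absurd (key s hs' hst.symm) hlt.not_gt
      · have hne : s ≠ z := fun h => hz (h ▸ hs')
        have hne' : t ≠ z := fun h => hz (h ▸ ht')
        rw [Function.update_of_ne hne, Function.update_of_ne hne'] at hst
        exact hmono s hs' t ht' hst hlt

/-- Only `k` colours occur, because a `k`-clique in the last set bounds them, and a class has at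
most `k` vertices if there is no larger clique. -/
theorem Chain.lt_omega [Finite V] {T : Tournament V} {k j : ℕ} {S G M : Finset V}
    (h : T.Chain k j S G M) (hj : k * k < j) : k < T.omega M := by
  classical
  by_contra hcon
  obtain ⟨f, hf, hk⟩ := (T.omega_le_iff M k).1 (not_lt.1 hcon)
  obtain ⟨col, hcol, hmono⟩ := h.exists_coloring hf hk
  obtain ⟨hSM, hSj, hGM, hGk⟩ := h.subset
  obtain ⟨Q, hQ, hQc, hQk⟩ := T.exists_backClique_of_le_omega hGk
    (hf.mono (Finset.coe_subset.2 hGM))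
  obtain ⟨i, -, hi⟩ := Finset.exists_lt_card_fiber_of_mul_lt_card_of_maps_to
    (s := S) (t := Finset.Icc 1 k) (f := col) (n := k) (fun s hs => by
      have h1 := (hcol s hs).2 Q (Finset.coe_subset.1 hQ) hQc hQk
      have h2 : before f Q s ≤ Q.card := Finset.card_filter_le _ _
      exact Finset.mem_Icc.2 ⟨(hcol s hs).1, by omega⟩) (by simpa [hSj] using hj)
  refine absurd (hk (S.filter fun s => col s = i) ?_ ?_) hi.not_ge
  · exact Finset.coe_subset.2 ((Finset.filter_subset _ _).trans hSM)
  · intro s hs t ht hst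
    rw [Finset.mem_filter] at hs ht
    exact hmono s hs.1 t ht.1 (hs.2.trans ht.2.symm) hst

/-- Every vertex above `F` with an in-neighbour in `W` is dominated by all of some chain in a
bounded family. To lengthen a chain `S`, note that its common out-neighbours above `F` contain no
cluster, hence have a small dominating set `P S`; each element of `P S` gives an extension. Blocking
`W`, `F` and all the sets `P S` at once restores the invariant. The size of `F` depends on the
length `j`, but not on `N`. -/
theorem exists_chain_family {k : ℕ} (hkpos : 0 < k) (K l N j : ℕ) : ∃ K' m c : ℕ,
    ∀ (V : Type u) [Finite V] (T : Tournament V),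
    (∀ Y, T.Undom Y K → T.HasCluster k l Y) → ∀ Y, T.Undom Y K' → ∀ F₀ : Finset V,
    F₀.card ≤ l → k ≤ T.omega F₀ → T.Complete Y F₀ → ¬ T.HasCluster (k + 1) m (Y ∪ F₀) →
    ∀ W : Finset V, ↑W ⊆ Y → W.card ≤ N →
    ∃ (F M G : Finset V) (𝒮 : Finset (Finset V)), ↑F ⊆ Y ∧ F.card ≤ (j + 1) * ((k + 2) * l) ∧
      G ⊆ F ∧ G.Nonempty ∧ T.Complete G W ∧ ↑M ⊆ Y ∪ F₀ ∧ M.card ≤ m ∧ 𝒮.card ≤ c ∧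
      (∀ S ∈ 𝒮, T.Chain k (j + 1) S G M ∧ ↑S ⊆ Y ∧
        ¬ T.HasCluster k l (Y ∩ {x | ∀ s ∈ S, T.Adj s x} ∩ T.above F)) ∧
      ∀ b ∈ W, ∀ x ∈ Y, x ∈ T.above F → T.Adj b x → ∃ S ∈ 𝒮, ∀ s ∈ S, T.Adj s x := by
  classical
  induction j with
  | zero =>
    obtain ⟨K', m, h⟩ := exists_blocking.{u} k K l N
    refine ⟨K', max m (l + N + (k + 2) * l), N, ?_⟩
    intro V _ T hcl Y hY F₀ hF₀ hF₀k hYF₀ hno W hW hN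
    obtain ⟨G, F, hGF, hF, hFl, hGk, hGW, hFno⟩ := h V T hcl Y hY
      (fun h' => hno (h'.mono Set.subset_union_left (le_max_left _ _))) W hW hN
    have hGne : G.Nonempty := by
      rw [← Finset.coe_nonempty]
      exact T.nonempty_of_omega_pos (hkpos.trans_le hGk)
    refine ⟨F, F₀ ∪ W ∪ F, G, W.image fun b => {b}, hF, by simpa using hFl, hGF, hGne, hGW, ?_,
      ?_, Finset.card_image_le.trans hN, ?_, ?_⟩
    · rw [Finset.coe_union, Finset.coe_union]
      exact Set.union_subset (Set.union_subset Set.subset_union_right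
        (hW.trans Set.subset_union_left)) (hF.trans Set.subset_union_left)
    · refine le_trans ?_ (le_max_right _ _)
      have h1 := Finset.card_union_le (F₀ ∪ W) F
      have h2 := Finset.card_union_le F₀ W
      omega
    · intro S hS
      obtain ⟨b, hb, rfl⟩ := Finset.mem_image.1 hS
      refine ⟨⟨∅, F₀, b, by simp, ⟨rfl, ?_, hF₀k⟩, by simp, ?_, ?_, hGk, ?_, ?_, ?_, by simp⟩,
        by simpa using hW hb, ?_⟩
      · exact Finset.subset_union_left.trans Finset.subset_union_left
      · exact Finset.mem_union_left _ (Finset.mem_union_right _ hb)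
      · exact hGF.trans Finset.subset_union_right
      · exact fun g hg => hYF₀ b (hW hb) g hg
      · exact fun g hg => hGW g hg b hb
      · exact fun x hx y hy => hYF₀ x (hF (hGF hx)) y hy
      · simpa using hFno b hb
    · intro b hb x _ _ hbx
      exact ⟨{b}, Finset.mem_image_of_mem _ hb, by simpa using hbx⟩
  | succ j ih =>
    obtain ⟨K₁, m₁, c₁, ih⟩ := ih
    obtain ⟨K₂, m₂, h⟩ := exists_blocking.{u} k K l (N + (j + 1) * ((k + 2) * l) + c₁ * K)
    refine ⟨max K₁ K₂, max m₂ (m₁ + (N + (j + 1) * ((k + 2) * l) + c₁ * K) + (k + 2) * l),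
      c₁ * K, ?_⟩
    intro V _ T hcl Y hY F₀ hF₀ hF₀k hYF₀ hno W hW hN
    obtain ⟨F, M, G, 𝒮, hF, hFl, hGF, hGne, hGW, hM, hMm, h𝒮c, h𝒮, hcov⟩ :=
      ih V T hcl Y (hY.mono (le_max_left _ _)) F₀ hF₀ hF₀k hYF₀ (fun h' => hno
        (h'.mono subset_rfl (le_max_of_le_right (by omega)))) W hW hN
    have hP : ∀ S : Finset V, ∃ P : Finset V,
        ↑P ⊆ Y ∩ {x | ∀ s ∈ S, T.Adj s x} ∩ T.above F ∧ P.card ≤ K ∧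
        (S ∈ 𝒮 → ∀ x ∈ Y ∩ {x | ∀ s ∈ S, T.Adj s x} ∩ T.above F, ∃ d ∈ P, ¬ T.Adj x d) := by
      intro S
      by_cases hS : S ∈ 𝒮
      · have : ¬ T.Undom _ K := fun h' => (h𝒮 S hS).2.2 (hcl _ h')
        simp only [Undom] at this
        push Not at this
        obtain ⟨P, h1, h2, h3⟩ := this
        exact ⟨P, h1, h2.le, fun _ => h3⟩
      · exact ⟨∅, by simp, by simp, fun h' => absurd h' hS⟩
    choose P hP hPK hPdom using hP
    set Z := W ∪ F ∪ 𝒮.biUnion P with hZ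
    have hZY : ↑Z ⊆ Y := by
      intro v hv
      rcases Finset.mem_union.1 (Finset.mem_coe.1 hv) with hv | hv
      · rcases Finset.mem_union.1 hv with hv | hv
        · exact hW hv
        · exact hF hv
      · obtain ⟨S, -, hv⟩ := Finset.mem_biUnion.1 hv
        exact (hP S hv).1.1
    have hZc : Z.card ≤ N + (j + 1) * ((k + 2) * l) + c₁ * K := by
      refine (Finset.card_union_le _ _).trans (add_le_add
        ((Finset.card_union_le _ _).trans (add_le_add hN hFl)) ?_)
      exact (Finset.card_biUnion_le_card_mul _ _ K fun S _ => hPK S).trans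
        (Nat.mul_le_mul_right _ h𝒮c)
    obtain ⟨G', F', hGF', hF', hFl', hGk', hGZ', hFno'⟩ := h V T hcl Y
      (hY.mono (le_max_right _ _))
      (fun h' => hno (h'.mono Set.subset_union_left (le_max_left _ _))) Z hZY hZc
    have hGne' : G'.Nonempty := by
      rw [← Finset.coe_nonempty]
      exact T.nonempty_of_omega_pos (hkpos.trans_le hGk')
    have hWZ : W ⊆ Z := Finset.subset_union_left.trans Finset.subset_union_left
    have hFZ : F ⊆ Z := Finset.subset_union_right.trans Finset.subset_union_left
    have hPZ : ∀ S ∈ 𝒮, P S ⊆ Z := fun S hS x hx =>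
      Finset.mem_union_right _ (Finset.mem_biUnion.2 ⟨S, hS, hx⟩)
    refine ⟨F ∪ F', M ∪ Z ∪ F', G', 𝒮.biUnion fun S => (P S).image fun p => insert p S,
      ?_, ?_, hGF'.trans Finset.subset_union_right, hGne', ?_, ?_, ?_, ?_, ?_, ?_⟩
    · rw [Finset.coe_union]
      exact Set.union_subset hF hF'
    · refine (Finset.card_union_le _ _).trans ?_
      rw [add_mul (j + 1), one_mul]
      exact add_le_add hFl hFl'
    · exact fun x hx y hy => hGZ' x hx y (hWZ hy)
    · rw [Finset.coe_union, Finset.coe_union]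
      exact Set.union_subset (Set.union_subset hM (hZY.trans Set.subset_union_left))
        (hF'.trans Set.subset_union_left)
    · refine le_trans ?_ (le_max_right _ _)
      have h1 := Finset.card_union_le (M ∪ Z) F'
      have h2 := Finset.card_union_le M Z
      omega
    · exact (Finset.card_biUnion_le_card_mul _ _ K fun S _ =>
        Finset.card_image_le.trans (hPK S)).trans (Nat.mul_le_mul_right _ h𝒮c)
    · intro S' hS'
      obtain ⟨S, hS, hS'⟩ := Finset.mem_biUnion.1 hS'
      obtain ⟨p, hp, rfl⟩ := Finset.mem_image.1 hS'
      obtain ⟨hch, hSY, -⟩ := h𝒮 S hS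
      have hpS : p ∉ S := fun h' => T.irrefl p ((hP S hp).1.2 p h')
      refine ⟨⟨S, G, p, hpS, hch.mono (Finset.subset_union_left.trans Finset.subset_union_left),
        by rw [Finset.cons_eq_insert], ?_, hGF'.trans Finset.subset_union_right, hGk', ?_, ?_, ?_,
        ?_⟩, ?_, ?_⟩
      · exact Finset.mem_union_left _ (Finset.mem_union_right _ (hPZ S hS hp))
      · exact fun g hg => (hP S hp).2 g (hGF hg)
      · exact fun g hg => hGZ' g hg p (hPZ S hS hp)
      · exact fun x hx y hy => hGZ' x hx y (hFZ (hGF hy))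
      · exact fun s hs => (hP S hp).1.2 s hs
      · rw [Finset.coe_insert]
        exact Set.insert_subset (hP S hp).1.1 hSY
      · refine fun h' => hFno' p (hPZ S hS hp) (h'.mono ?_ le_rfl)
        rintro x ⟨⟨hx1, hx2⟩, hx3⟩
        exact ⟨⟨hx1, hx2 p (Finset.mem_insert_self _ _)⟩,
          fun u hu => hx3 u (Finset.mem_union_right _ hu)⟩
    · intro b hb x hxY hxF hbx
      have hxF1 : x ∈ T.above F := fun u hu => hxF u (Finset.mem_union_left _ hu)
      obtain ⟨S, hS, hSx⟩ := hcov b hb x hxY hxF1 hbx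
      obtain ⟨d, hd, hxd⟩ := hPdom S hS x ⟨⟨hxY, hSx⟩, hxF1⟩
      -- `G'` dominates `d` but is dominated by `x`.
      have hne : x ≠ d := by
        rintro rfl
        obtain ⟨g, hg⟩ := hGne'
        exact T.asymm _ _ (hGZ' g hg x (hPZ S hS hd))
          (hxF g (Finset.mem_union_right _ (hGF' hg)))
      refine ⟨insert d S, Finset.mem_biUnion.2 ⟨S, hS, Finset.mem_image_of_mem _ hd⟩, ?_⟩
      intro s hs
      rcases Finset.mem_insert.1 hs with rfl | hs
      · exact T.adj_of_not_adj hne hxd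
      · exact hSx s hs

/-- Large domination number forces a subtournament of bounded size with large clique number. -/
theorem exists_hasCluster_of_undom (k : ℕ) : ∃ K l : ℕ, ∀ (V : Type u) [Finite V]
    (T : Tournament V) (Y : Set V), T.Undom Y K → T.HasCluster k l Y := by
  classical
  induction k with
  | zero => exact ⟨0, 0, fun V _ T Y _ => ⟨∅, by simp, by simp, Nat.zero_le _⟩⟩
  | succ k ih =>
    rcases Nat.eq_zero_or_pos k with rfl | hk
    · refine ⟨1, 1, fun V _ T Y hY => ?_⟩
      obtain ⟨v, hv, -⟩ := hY ∅ (by simp) (by simp)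
      exact ⟨{v}, by simpa using hv, by simp, T.omega_pos_of_mem (x := v) (by simp)⟩
    · obtain ⟨K, l, ih⟩ := ih
      -- Chains will have length `k * k + 1`, too long to exist. `N` is one more than the bound on
      -- `|F|` for that length, so that replacing `W` by `F` saves a vertex.
      obtain ⟨K', m, c, hfam⟩ := exists_chain_family.{u} hk K l
        ((k * k + 1) * ((k + 2) * l) + 1) (k * k)
      refine ⟨max K (l + max K' ((k * k + 1) * ((k + 2) * l) + 1)), m, ?_⟩
      intro V _ T Y hY
      by_contra hno
      obtain ⟨F₀, hF₀Y, hF₀l, hF₀k⟩ := ih V T Y (hY.mono (le_max_left _ _))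
      have hY' := (hY.mono (le_max_right _ _)).inter_above hF₀Y (Nat.add_le_add_right hF₀l _)
      set Y' := Y ∩ T.above F₀ with hYdef
      -- `D` is a smallest dominating set of `Y'` and `W` a part of it. As there are no long chains,
      -- no vertex dominated by `W` lies above `F`, so `F` takes over the role of `W` and
      -- contradicts minimality.
      have hex : ∃ n, ∃ D : Finset V, ↑D ⊆ Y' ∧ D.card = n ∧ ∀ v ∈ Y', ∃ d ∈ D, ¬ T.Adj v d :=
        ⟨_, (Set.toFinite Y').toFinset, by simp, rfl, fun v hv => ⟨v, by simpa using hv,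
          T.irrefl v⟩⟩
      obtain ⟨D, hDY, hDn, hDdom⟩ := Nat.find_spec hex
      have hDcard : (k * k + 1) * ((k + 2) * l) + 1 ≤ D.card := by
        by_contra hlt
        obtain ⟨v, hv, hvD⟩ := hY' D hDY (lt_max_of_lt_right (not_le.1 hlt))
        obtain ⟨d, hd, hvd⟩ := hDdom v hv
        exact hvd (hvD d hd)
      obtain ⟨W, hWD, hWc⟩ := Finset.exists_subset_card_eq hDcard
      obtain ⟨F, M, G, 𝒮, hF, hFl, hGF, hGne, hGW, hM, hMm, -, h𝒮, hcov⟩ :=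
        hfam V T (ih V T) Y' (hY'.mono (le_max_left _ _)) F₀ hF₀l hF₀k (fun y hy u hu => hy.2 u hu)
          (fun h' => hno (h'.mono (Set.union_subset Set.inter_subset_left hF₀Y) le_rfl)) W
          ((Finset.coe_subset.2 hWD).trans hDY) hWc.le
      have hempty : ∀ S, S ∉ 𝒮 := by
        intro S hS
        refine hno ⟨M, hM.trans (Set.union_subset Set.inter_subset_left hF₀Y), hMm, ?_⟩
        exact (h𝒮 S hS).1.lt_omega (Nat.lt_succ_self _)
      have hlt : ((D \ W) ∪ F).card < Nat.find hex := by
        have h1 := Finset.card_union_le (D \ W) F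
        have h2 := Finset.card_sdiff_of_subset hWD
        have h3 := Finset.card_le_card hWD
        omega
      refine Nat.find_min hex hlt ⟨_, ?_, rfl, ?_⟩
      · rw [Finset.coe_union]
        exact Set.union_subset ((Finset.coe_subset.2 Finset.sdiff_subset).trans hDY) hF
      · intro v hv
        obtain ⟨d, hd, hvd⟩ := hDdom v hv
        by_cases hdW : d ∈ W
        · by_contra hcon
          push Not at hcon
          have hvF : v ∈ T.above F := fun u hu => hcon u (Finset.mem_union_right _ hu)
          by_cases hne : v = d
          · obtain ⟨g, hg⟩ := hGne
            subst hne
            exact T.asymm _ _ (hGW g hg v hdW) (hvF g (hGF hg))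
          · obtain ⟨S, hS, -⟩ := hcov d hdW v hv hvF (T.adj_of_not_adj hne hvd)
            exact hempty S hS
        · exact ⟨d, Finset.mem_union_left _ (Finset.mem_sdiff.2 ⟨hd, hdW⟩), hvd⟩

/-- A tournament in which all out-neighbourhoods have bounded clique number has bounded clique
number. -/
theorem exists_omega_le_of_outNbr (h : ℕ) : ∃ g : ℕ, ∀ (V : Type u) [Finite V] (T : Tournament V)
    (Z : Set V), (∀ v ∈ Z, T.omega (Z ∩ T.outNbr v) ≤ h) → T.omega Z ≤ g := by
  classical
  obtain ⟨K, l, hcl⟩ := exists_hasCluster_of_undom.{u} (h + 1)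
  refine ⟨max K l * (h + 1), fun V _ T Z hZ => ?_⟩
  have hdom : ∀ D : Finset V, ↑D ⊆ Z → D.card ≤ max K l →
      (∀ v ∈ Z, ¬ ∀ d ∈ D, T.Adj v d) → T.omega Z ≤ max K l * (h + 1) := by
    intro D hD hDc hDdom
    have : Z ⊆ ⋃ d ∈ D, insert d (Z ∩ T.outNbr d) := by
      intro v hv
      have := hDdom v hv
      push Not at this
      obtain ⟨d, hd, hvd⟩ := this
      refine Set.mem_biUnion hd ?_
      by_cases hne : v = d
      · exact Or.inl hne
      · exact Or.inr ⟨hv, T.adj_of_not_adj hne hvd⟩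
    refine (T.omega_mono this).trans ((T.omega_biUnion_le D _ (h + 1) fun d hd => ?_).trans
      (Nat.mul_le_mul_right _ hDc))
    exact (T.omega_insert_le _ _).trans (Nat.add_le_add_right (hZ d (hD hd)) 1)
  -- If the domination number is large, a bounded set `X` of clique number `h + 1` exists. No
  -- out-neighbourhood of a vertex of `Z` contains `X`, so `X` is itself a dominating set. Thus `Z`
  -- is covered by boundedly many closed out-neighbourhoods in either case.
  by_cases hu : T.Undom Z K
  · obtain ⟨X, hX, hXl, hXk⟩ := hcl V T Z hu
    refine hdom X hX (hXl.trans (le_max_right _ _)) fun v hv hvX => ?_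
    have : (X : Set V) ⊆ Z ∩ T.outNbr v := fun x hx => ⟨hX hx, hvX x hx⟩
    have := (T.omega_mono this).trans (hZ v hv)
    omega
  · simp only [Undom] at hu
    push Not at hu
    obtain ⟨D, hD, hDc, hDdom⟩ := hu
    refine hdom D hD (hDc.le.trans (le_max_left _ _)) fun v hv hvD => ?_
    obtain ⟨d, hd, hvd⟩ := hDdom v hv
    exact hvd (hvD d hd)

/-- The tournament with all arcs reversed. -/
def reverse : Tournament V where
  Adj x y := T.Adj y x
  asymm x y h := T.asymm y x h
  total x y h := (T.total x y h).symm

theorem omega_reverse [Finite V] (X : Set V) : T.reverse.omega X = T.omega X := by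
  have key : ∀ T : Tournament V, ∀ k, T.omega X ≤ k → T.reverse.omega X ≤ k := by
    classical
    have := Fintype.ofFinite V
    intro T k h
    obtain ⟨f, hf, hk⟩ := (T.omega_le_iff X k).1 h
    set N := Finset.univ.sup f
    have hN : ∀ v, f v ≤ N := fun v => Finset.le_sup (Finset.mem_univ v)
    refine (T.reverse.omega_le_iff X k).2 ⟨fun v => N - f v, ?_, ?_⟩
    · intro a ha b hb hab
      have h1 := hN a
      have h2 := hN b
      exact hf ha hb (by simp only at hab; omega)
    · intro Q hQ hc
      refine hk Q hQ fun x hx y hy hxy => hc y hy x hx ?_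
      have h1 := hN x
      have h2 := hN y
      simp only
      omega
  exact le_antisymm (key T _ le_rfl) (key T.reverse _ le_rfl)

/-- A set with large clique number has a vertex with both neighbourhoods large. -/
theorem exists_both_large (h : ℕ) : ∃ g : ℕ, ∀ (V : Type u) [Finite V] (T : Tournament V)
    (Z : Set V), g < T.omega Z → ∃ v ∈ Z, h < T.omega (Z ∩ T.outNbr v) ∧
      h < T.omega (Z ∩ T.inNbr v) := by
  obtain ⟨g, hg⟩ := exists_omega_le_of_outNbr.{u} h
  refine ⟨g + g, fun V _ T Z hZ => ?_⟩
  by_contra hcon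
  push Not at hcon
  -- The vertices with small out-neighbourhood form a set of clique number at most `g`; by reversal,
  -- so do those with small in-neighbourhood. Together they cannot exhaust `Z`.
  have h1 := hg V T (Z ∩ {v | T.omega (Z ∩ T.outNbr v) ≤ h}) fun v hv =>
    (T.omega_mono (Set.inter_subset_inter_left _ Set.inter_subset_left)).trans hv.2
  have h2 := hg V T.reverse (Z ∩ {v | T.omega (Z ∩ T.inNbr v) ≤ h}) fun v hv => by
    rw [omega_reverse]
    exact (T.omega_mono (Set.inter_subset_inter_left _ Set.inter_subset_left)).trans hv.2
  rw [omega_reverse] at h2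
  have h3 : Z ⊆ (Z ∩ {v | T.omega (Z ∩ T.outNbr v) ≤ h}) ∪
      (Z ∩ {v | T.omega (Z ∩ T.inNbr v) ≤ h}) := by
    intro v hv
    by_cases hv' : T.omega (Z ∩ T.outNbr v) ≤ h
    · exact Or.inl ⟨hv, hv'⟩
    · exact Or.inr ⟨hv, hcon v hv (not_le.1 hv')⟩
  have := (T.omega_mono h3).trans (T.omega_union_le _ _)
  omega

end Domination
end Tournament

namespace Tournament

/-! ### Splitting a set of large clique number into a bag-chain -/

section Forward

variable {V : Type u} (T : Tournament V)

/-- The condition on two bags, `X` before `Y`, of a bag-chain. -/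
def Forward (c : ℕ) (X Y : Set V) : Prop :=
  Disjoint X Y ∧ (∀ v ∈ Y, T.omega (T.outNbr v ∩ X) < c) ∧ ∀ w ∈ X, T.omega (T.inNbr w ∩ Y) < c

variable {T}

theorem Forward.mono [Finite V] {c : ℕ} {X Y X' Y' : Set V} (h : T.Forward c X Y) (hX : X' ⊆ X)
    (hY : Y' ⊆ Y) : T.Forward c X' Y' := by
  obtain ⟨h1, h2, h3⟩ := h
  refine ⟨h1.mono hX hY, fun v hv => ?_, fun w hw => ?_⟩
  · exact (T.omega_mono (Set.inter_subset_inter_right _ hX)).trans_lt (h2 v (hY hv))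
  · exact (T.omega_mono (Set.inter_subset_inter_right _ hY)).trans_lt (h3 w (hX hw))

variable (T)

/-- Without `N` vertices that span only heavy arcs, a set with large clique number splits off a
bag-chain of length two. -/
theorem exists_forward_of_no_heavy (N q L : ℕ) : ∃ w : ℕ, ∀ (V : Type u) [Finite V]
    (T : Tournament V) (Z : Set V), w < T.omega Z →
    (¬ ∃ S : Finset V, ↑S ⊆ Z ∧ S.card = N ∧
      ∀ x ∈ S, ∀ y ∈ S, T.Adj x y → q ≤ T.omega (Z ∩ T.cyc x y)) →
    ∃ X Y : Set V, X ⊆ Z ∧ Y ⊆ Z ∧ L ≤ T.omega X ∧ L ≤ T.omega Y ∧ T.Forward q X Y := by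
  classical
  induction N with
  | zero => exact ⟨0, fun V _ T Z _ h => absurd ⟨∅, by simp, rfl, by simp⟩ h⟩
  | succ N ih =>
    obtain ⟨w, ih⟩ := ih
    obtain ⟨g, hg⟩ := exists_both_large.{u} (L + w)
    refine ⟨g, fun V _ T Z hZ hno => ?_⟩
    obtain ⟨v, hvZ, hout, hin⟩ := hg V T Z hZ
    -- `H` consists of the vertices joined to `v` by a heavy arc. If it is large, recursion inside
    -- `H` works, since `v` would complete a heavy set of size `N`. Otherwise its removal from both
    -- neighbourhoods of `v` leaves the two bags: a backward arc from `y` to `x` between them puts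
    -- `x` in `cyc v y` and `y` in `cyc x v`.
    let H : Set V := {u | u ∈ Z ∧ ((T.Adj v u ∧ q ≤ T.omega (Z ∩ T.cyc v u)) ∨
      (T.Adj u v ∧ q ≤ T.omega (Z ∩ T.cyc u v)))}
    have hHZ : H ⊆ Z := fun u hu => hu.1
    by_cases hH : w < T.omega H
    · obtain ⟨X, Y, hX, hY, h⟩ := ih V T H hH (by
        rintro ⟨S, hS, hSN, hh⟩
        have hvS : v ∉ S := by
          intro hvS
          rcases (hS hvS).2 with h | h <;> exact T.irrefl v h.1
        refine hno ⟨insert v S, ?_, by rw [Finset.card_insert_of_notMem hvS, hSN], ?_⟩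
        · rw [Finset.coe_insert]
          exact Set.insert_subset hvZ (hS.trans hHZ)
        · intro x hx y hy hxy
          rcases Finset.mem_insert.1 hx with hx' | hx' <;>
            rcases Finset.mem_insert.1 hy with hy' | hy'
          · rw [hx', hy'] at hxy
            exact absurd hxy (T.irrefl _)
          · rw [hx'] at hxy ⊢
            rcases (hS hy').2 with h | h
            · exact h.2
            · exact absurd h.1 (T.asymm _ _ hxy)
          · rw [hy'] at hxy ⊢
            rcases (hS hx').2 with h | h
            · exact absurd h.1 (T.asymm _ _ hxy)
            · exact h.2
          · exact (hh x hx' y hy' hxy).trans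
              (T.omega_mono (Set.inter_subset_inter_left _ hHZ)))
      exact ⟨X, Y, hX.trans hHZ, hY.trans hHZ, h⟩
    · have hlarge : ∀ A : Set V, L + w < T.omega A → L ≤ T.omega (A \ H) := by
        intro A hA
        have h1 := T.omega_le_diff_add A H
        have h2 := T.omega_mono (X := A ∩ H) (Y := H) Set.inter_subset_right
        omega
      refine ⟨(Z ∩ T.inNbr v) \ H, (Z ∩ T.outNbr v) \ H, fun x hx => hx.1.1, fun x hx => hx.1.1,
        hlarge _ hin, hlarge _ hout, ?_, ?_, ?_⟩
      · exact Set.disjoint_left.2 fun x hx hy => T.asymm _ _ hx.1.2 hy.1.2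
      · intro y hy
        by_contra hcon
        refine hy.2 ⟨hy.1.1, Or.inl ⟨hy.1.2, (not_lt.1 hcon).trans (T.omega_mono ?_)⟩⟩
        exact fun z hz => ⟨hz.2.1.1, hz.1, hz.2.1.2⟩
      · intro x hx
        by_contra hcon
        refine hx.2 ⟨hx.1.1, Or.inr ⟨hx.1.2, (not_lt.1 hcon).trans (T.omega_mono ?_)⟩⟩
        exact fun z hz => ⟨hz.2.1.1, hz.2.1.2, hz.1⟩

/-- There is no cyclic arrangement of a vertex and two sets satisfying the monotone property `Φ`,
while each set with clique number at least `c` has at most `s` vertices that form a set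
satisfying `Φ`. -/
structure DeltaFree (Φ : Set V → Prop) (c s : ℕ) : Prop where
  mono : ∀ X Y : Set V, X ⊆ Y → Φ X → Φ Y
  exists_small : ∀ X : Set V, c ≤ T.omega X → ∃ M : Finset V, ↑M ⊆ X ∧ M.card ≤ s ∧ Φ M
  no_delta : ∀ (v : V) (X Y : Set V), X ⊆ T.outNbr v → Y ⊆ T.inNbr v → T.Complete X Y → Φ X →
    Φ Y → False

variable {T}

theorem DeltaFree.of_le_omega {Φ : Set V → Prop} {c s : ℕ} (h : T.DeltaFree Φ c s) {X : Set V}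
    (hX : c ≤ T.omega X) : Φ X := by
  obtain ⟨M, hM, -, hΦ⟩ := h.exists_small X hX
  exact h.mono _ _ hM hΦ

/-- The out-neighbours in `P` of `v ∈ R` satisfy `v → N⁺(v) ∩ P → M → v`, and dually for `w ∈ P`; so
these sets cannot satisfy `Φ`. -/
theorem DeltaFree.forward {Φ : Set V → Prop} {c s : ℕ} (h : T.DeltaFree Φ c s) {P M R : Set V}
    (hPR : Disjoint P R) (hPM : T.Complete P M) (hMR : T.Complete M R) (hM : Φ M) :
    T.Forward c P R := by
  refine ⟨hPR, fun v hv => ?_, fun w hw => ?_⟩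
  · by_contra hcon
    exact h.no_delta v (T.outNbr v ∩ P) M (fun x hx => hx.1) (fun m hm => hMR m hm v hv)
      (fun x hx y hy => hPM x hx.2 y hy) (h.of_le_omega (not_lt.1 hcon)) hM
  · by_contra hcon
    exact h.no_delta w M (T.inNbr w ∩ R) (fun m hm => hPM w hw m hm) (fun x hx => hx.1)
      (fun x hx y hy => hMR x hx y hy.2) hM (h.of_le_omega (not_lt.1 hcon))

/-- Removing from `X` the sets `B m`, for `m` in a small set `M`. -/
theorem omega_le_diff_biUnion [Finite V] (X : Set V) (M : Finset V) (B : V → Set V) (q s : ℕ)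
    (hs : M.card ≤ s) (hB : ∀ m ∈ M, T.omega (B m ∩ X) ≤ q) :
    T.omega X ≤ T.omega (X \ ⋃ m ∈ M, B m) + s * q := by
  refine (T.omega_le_diff_add X (⋃ m ∈ M, B m)).trans (Nat.add_le_add_left ?_ _)
  have : X ∩ ⋃ m ∈ M, B m = ⋃ m ∈ M, B m ∩ X := by
    ext x
    simp only [Set.mem_inter_iff, Set.mem_iUnion, exists_prop]
    constructor
    · rintro ⟨hx, m, hm, h⟩
      exact ⟨m, hm, h, hx⟩
    · rintro ⟨m, hm, h, hx⟩
      exact ⟨hx, m, hm, h⟩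
  rw [this]
  exact (T.omega_biUnion_le M _ q hB).trans (Nat.mul_le_mul_right _ hs)

/-- Improves the parameter from an arbitrary `q` to `c`, at the cost of the middle bag: clean the
outer bags from the backward neighbours of a small set `M` in the middle one that satisfies `Φ`,
losing at most `s * q`. -/
theorem DeltaFree.exists_forward_of_three [Finite V] {Φ : Set V → Prop} {c s q l : ℕ}
    (h : T.DeltaFree Φ c s) {X Y Z : Set V} (hXY : T.Forward q X Y) (hXZ : T.Forward q X Z)
    (hYZ : T.Forward q Y Z) (hX : l + s * q ≤ T.omega X) (hY : c ≤ T.omega Y)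
    (hZ : l + s * q ≤ T.omega Z) : ∃ P R : Set V, P ⊆ X ∧ R ⊆ Z ∧ l ≤ T.omega P ∧
      l ≤ T.omega R ∧ T.Forward c P R := by
  obtain ⟨M, hM, hMs, hΦ⟩ := h.exists_small Y hY
  refine ⟨X \ ⋃ m ∈ M, T.outNbr m, Z \ ⋃ m ∈ M, T.inNbr m, Set.sdiff_subset, Set.sdiff_subset,
    ?_, ?_, h.forward (M := M) ?_ ?_ ?_ hΦ⟩
  · have := T.omega_le_diff_biUnion X M T.outNbr q s hMs fun m hm => (hXY.2.1 m (hM hm)).le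
    omega
  · have := T.omega_le_diff_biUnion Z M T.inNbr q s hMs fun m hm => (hYZ.2.2 m (hM hm)).le
    omega
  · exact hXZ.1.mono Set.sdiff_subset Set.sdiff_subset
  · intro x hx m hm
    refine T.adj_of_not_adj (fun hmx => ?_) fun hmx => hx.2 (Set.mem_biUnion hm hmx)
    exact Set.disjoint_left.1 hXY.1 hx.1 (hmx ▸ hM hm)
  · intro m hm x hx
    refine T.adj_of_not_adj (fun hmx => ?_) fun hmx => hx.2 (Set.mem_biUnion hm hmx)
    exact Set.disjoint_left.1 hYZ.1 (hM hm) (hmx ▸ hx.1)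

variable (T)

/-- `Z` contains a `c`-bag-chain of length two with bags of clique number at least `l`. -/
def HasForwardPair (l c : ℕ) (Z : Set V) : Prop :=
  ∃ X Y : Set V, X ⊆ Z ∧ Y ⊆ Z ∧ l ≤ T.omega X ∧ l ≤ T.omega Y ∧ T.Forward c X Y

theorem HasForwardPair.mono {T : Tournament V} {l c : ℕ} {Z Z' : Set V}
    (h : T.HasForwardPair l c Z) (hZ : Z ⊆ Z') : T.HasForwardPair l c Z' := by
  obtain ⟨X, Y, h1, h2, h3⟩ := h
  exact ⟨X, Y, h1.trans hZ, h2.trans hZ, h3⟩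

theorem exists_heavy_set_of_no_pair (l c s N q : ℕ) : ∃ w : ℕ, ∀ (V : Type u) [Finite V]
    (T : Tournament V) (Φ : Set V → Prop), T.DeltaFree Φ c s → ∀ Z : Set V,
    ¬ T.HasForwardPair l c Z → w < T.omega Z → ∃ S : Finset V, ↑S ⊆ Z ∧ S.card = N ∧
      ∀ x ∈ S, ∀ y ∈ S, T.Adj x y → q ≤ T.omega (Z ∩ T.cyc x y) := by
  obtain ⟨w₁, h₁⟩ := exists_forward_of_no_heavy.{u} N q (max (l + s * q) c)
  -- The second bag of the first split is kept large enough to be split again, giving three bags.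
  obtain ⟨w₂, h₂⟩ := exists_forward_of_no_heavy.{u} N q (max (l + s * q) (w₁ + 1))
  refine ⟨w₂, fun V _ T Φ hΦ Z hno hZ => ?_⟩
  by_contra hcon
  obtain ⟨X, Y, hX, hY, hXl, hYl, hXY⟩ := h₂ V T Z hZ hcon
  obtain ⟨Y₁, Y₂, hY₁, hY₂, hY₁l, hY₂l, hYY⟩ := h₁ V T Y
    (lt_of_lt_of_le (Nat.lt_succ_self _) ((le_max_right _ _).trans hYl)) (by
      rintro ⟨S, hS, hSN, hh⟩
      exact hcon ⟨S, hS.trans hY, hSN, fun x hx y hy hxy => (hh x hx y hy hxy).trans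
        (T.omega_mono (Set.inter_subset_inter_left _ hY))⟩)
  obtain ⟨P, R, hP, hR, hPl, hRl, hPR⟩ := hΦ.exists_forward_of_three (l := l)
    (hXY.mono subset_rfl hY₁) (hXY.mono subset_rfl hY₂) hYY ((le_max_left _ _).trans hXl)
    ((le_max_right _ _).trans hY₁l) ((le_max_left _ _).trans hY₂l)
  exact hno ⟨P, R, hP.trans hX, (hR.trans hY₂).trans hY, hPl, hRl, hPR⟩

/-- The absence of a forward pair passes to subsets, so heavy sets are found again inside `Z ∩ cyc x
y` for every heavy arc. -/
theorem exists_nest_of_no_pair (l c s N d : ℕ) : ∃ w : ℕ, ∀ (V : Type u) [Finite V]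
    (T : Tournament V) (Φ : Set V → Prop), T.DeltaFree Φ c s → ∀ Z : Set V,
    ¬ T.HasForwardPair l c Z → w < T.omega Z → T.Nest N d Z := by
  induction d with
  | zero => exact ⟨0, fun _ _ _ _ _ _ _ _ => trivial⟩
  | succ d ih =>
    obtain ⟨w, ih⟩ := ih
    obtain ⟨w', h⟩ := exists_heavy_set_of_no_pair.{u} l c s N (w + 1)
    refine ⟨w', fun V _ T Φ hΦ Z hno hZ => ?_⟩
    obtain ⟨S, hS, hSN, hh⟩ := h V T Φ hΦ Z hno hZ
    refine ⟨S, hS, hSN, fun x hx y hy hxy => ih V T Φ hΦ _ ?_ (hh x hx y hy hxy)⟩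
    exact fun h' => hno (h'.mono Set.inter_subset_left)

theorem exists_hasCluster_of_no_pair (l c s k : ℕ) : ∃ w m : ℕ, ∀ (V : Type u) [Finite V]
    (T : Tournament V) (Φ : Set V → Prop), T.DeltaFree Φ c s → ∀ Z : Set V,
    ¬ T.HasForwardPair l c Z → w < T.omega Z → T.HasCluster k m Z := by
  obtain ⟨w, h⟩ := exists_nest_of_no_pair.{u} l c s ((k * k + 1) * k + 1) (k * k + 1)
  obtain ⟨m, hm⟩ := exists_nest_finset.{u} ((k * k + 1) * k + 1) (k * k + 1)
  refine ⟨w, m, fun V _ T Φ hΦ Z hno hZ => ?_⟩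
  obtain ⟨X, hX, hXm, hXn⟩ := hm V T Z (h V T Φ hΦ Z hno hZ)
  exact ⟨X, hX, hXm, (T.lt_omega_of_nest (Nat.lt_succ_self _) hXn).le⟩

/-- Some set of vertices with the same out-neighbours in `M` has large clique number. -/
theorem exists_large_class [Finite V] (M : Finset V) {m t : ℕ} (hm : M.card ≤ m) {Y : Set V}
    (hY : 2 ^ m * t < T.omega Y) :
    ∃ S : Finset V, S ⊆ M ∧ t < T.omega {y | y ∈ Y ∧ ∀ x ∈ M, x ∈ S ↔ T.Adj y x} := by
  classical
  by_contra hcon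
  push Not at hcon
  have hsub : Y ⊆ ⋃ S ∈ M.powerset, {y | y ∈ Y ∧ ∀ x ∈ M, x ∈ S ↔ T.Adj y x} := by
    intro y hy
    refine Set.mem_biUnion (x := M.filter fun x => T.Adj y x)
      (Finset.mem_powerset.2 (Finset.filter_subset _ _)) ⟨hy, fun x hx => ?_⟩
    simp [hx]
  have h1 := (T.omega_mono hsub).trans (T.omega_biUnion_le M.powerset _ t
    fun S hS => hcon S (Finset.mem_powerset.1 hS))
  rw [Finset.card_powerset] at h1
  have h2 := Nat.mul_le_mul_right t (Nat.pow_le_pow_right (n := 2) (by norm_num) hm)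
  omega

/-- Suppose there is no pair. Choose `v`, then `b ∈ N⁻(v)`, and a bounded set `M` in `N⁻(v) ∩ N⁺(b)`
of clique number at least `3c`. A large `P ⊆ N⁻(v) ∩ N⁻(b)` dominates `S ⊆ M` and is dominated by `M
\ S`; then `b → M \ S → P → b` makes `M \ S` small. A large `R ⊆ N⁺(v)` dominates `U ⊆ S` and is
dominated by `S \ U`; then `v → R → U → v` makes `U` small. What remains has `P → S \ U → R`, so
`DeltaFree.forward` applies. -/
theorem exists_hasForwardPair (l c s : ℕ) : ∃ w : ℕ, ∀ (V : Type u) [Finite V]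
    (T : Tournament V) (Φ : Set V → Prop), T.DeltaFree Φ c s → ∀ Z : Set V,
    w < T.omega Z → T.HasForwardPair l c Z := by
  classical
  -- Of `3 * c`, fewer than `c` are lost to each of `M \ S` and `U`, and `c` must remain. The
  -- classes get `l + c`: `l` for the bag and `c` to guarantee `Φ`.
  obtain ⟨w₀, m, hcl⟩ := exists_hasCluster_of_no_pair.{u} l c s (3 * c)
  obtain ⟨g₂, hg₂⟩ := exists_both_large.{u} (max w₀ (2 ^ m * (l + c)))
  obtain ⟨g₁, hg₁⟩ := exists_both_large.{u} (max g₂ (2 ^ m * (l + c)))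
  refine ⟨g₁, fun V _ T Φ hΦ Z hZ => ?_⟩
  by_contra hno
  obtain ⟨v, hv, hvo, hvi⟩ := hg₁ V T Z hZ
  obtain ⟨b, hb, hbo, hbi⟩ := hg₂ V T _ ((le_max_left _ _).trans_lt hvi)
  obtain ⟨M, hM, hMm, hMc⟩ := hcl V T Φ hΦ _
    (fun h => hno (h.mono (Set.inter_subset_left.trans Set.inter_subset_left)))
    ((le_max_left _ _).trans_lt hbo)
  obtain ⟨S, hS, hSl⟩ := T.exists_large_class M hMm ((le_max_right _ _).trans_lt hbi)
  set P : Set V := {y | y ∈ Z ∩ T.inNbr v ∩ T.inNbr b ∧ ∀ x ∈ M, x ∈ S ↔ T.Adj y x}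
  have hPS : T.Complete P S := fun y hy x hx => (hy.2 x (hS hx)).1 hx
  have hMS : T.omega (↑(M \ S) : Set V) < c := by
    by_contra hcon
    refine hΦ.no_delta b (↑(M \ S)) P ?_ (fun y hy => hy.1.2) ?_ (hΦ.of_le_omega (not_lt.1 hcon))
      (hΦ.of_le_omega (by omega))
    · exact fun x hx => (hM (Finset.mem_sdiff.1 hx).1).2
    · intro x hx y hy
      have hx' := Finset.mem_sdiff.1 (Finset.mem_coe.1 hx)
      refine T.adj_of_not_adj (fun hxy => ?_) fun h => hx'.2 ((hy.2 x hx'.1).2 h)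
      exact T.asymm _ _ hy.1.2 (hxy ▸ (hM hx'.1).2)
  obtain ⟨U, hU, hUl⟩ := T.exists_large_class S ((Finset.card_le_card hS).trans hMm)
    ((le_max_right _ _).trans_lt hvo)
  set R : Set V := {y | y ∈ Z ∩ T.outNbr v ∧ ∀ x ∈ S, x ∈ U ↔ T.Adj y x}
  have hSin : ∀ x ∈ S, T.Adj x v := fun x hx => (hM (hS hx)).1.2
  have hUc : T.omega (↑U : Set V) < c := by
    by_contra hcon
    exact hΦ.no_delta v R U (fun y hy => hy.1.2) (fun x hx => hSin x (hU hx))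
      (fun y hy x hx => (hy.2 x (hU hx)).1 hx) (hΦ.of_le_omega (by omega))
      (hΦ.of_le_omega (not_lt.1 hcon))
  have hSU : c ≤ T.omega (↑(S \ U) : Set V) := by
    have h1 := T.omega_union_le (↑(M \ S) : Set V) ↑S
    have h2 := T.omega_union_le (↑(S \ U) : Set V) ↑U
    rw [← Finset.coe_union, Finset.sdiff_union_of_subset hS] at h1
    rw [← Finset.coe_union, Finset.sdiff_union_of_subset hU] at h2
    omega
  refine hno ⟨P, R, fun y hy => hy.1.1.1, fun y hy => hy.1.1, by omega, by omega,
    hΦ.forward (M := ↑(S \ U)) ?_ ?_ ?_ (hΦ.of_le_omega hSU)⟩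
  · exact Set.disjoint_left.2 fun y hy hy' => T.asymm _ _ hy.1.1.2 hy'.1.2
  · exact fun y hy x hx => hPS y hy x (Finset.mem_sdiff.1 hx).1
  · intro x hx y hy
    have hx' := Finset.mem_sdiff.1 (Finset.mem_coe.1 hx)
    refine T.adj_of_not_adj (fun hxy => ?_) fun h => hx'.2 ((hy.2 x hx'.1).2 h)
    exact T.asymm _ _ hy.1.2 (hxy ▸ hSin x hx'.1)

theorem exists_forward_list (l c s r : ℕ) : ∃ w : ℕ, ∀ (V : Type u) [Finite V]
    (T : Tournament V) (Φ : Set V → Prop), T.DeltaFree Φ c s → ∀ Z : Set V,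
    w < T.omega Z → ∃ L : List (Set V), L.length = 2 ^ r ∧ L.Pairwise (T.Forward c) ∧
      ∀ B ∈ L, B ⊆ Z ∧ l ≤ T.omega B := by
  induction r with
  | zero =>
    exact ⟨l, fun V _ T Φ _ Z hZ => ⟨[Z], rfl, List.pairwise_singleton _ _, by simpa using hZ.le⟩⟩
  | succ r ih =>
    obtain ⟨w, ih⟩ := ih
    obtain ⟨w', h⟩ := exists_hasForwardPair.{u} (w + 1) c s
    refine ⟨w', fun V _ T Φ hΦ Z hZ => ?_⟩
    obtain ⟨X, Y, hX, hY, hXw, hYw, hXY⟩ := h V T Φ hΦ Z hZ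
    obtain ⟨L₁, h1, h2, h3⟩ := ih V T Φ hΦ X hXw
    obtain ⟨L₂, g1, g2, g3⟩ := ih V T Φ hΦ Y hYw
    refine ⟨L₁ ++ L₂, by rw [List.length_append, h1, g1, pow_succ]; ring, ?_, ?_⟩
    · exact List.pairwise_append.2
        ⟨h2, g2, fun A hA B hB => hXY.mono (h3 A hA).1 (g3 B hB).1⟩
    · intro B hB
      rcases List.mem_append.1 hB with hB | hB
      · exact ⟨(h3 B hB).1.trans hX, (h3 B hB).2⟩
      · exact ⟨(g3 B hB).1.trans hY, (g3 B hB).2⟩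

theorem exists_isBagChain_of_list [Finite V] {l c : ℕ} (hl : 0 < l) (hc : 0 < c)
    {L : List (Set V)} (hL : L.Pairwise (T.Forward c)) (hLl : ∀ B ∈ L, l ≤ T.omega B) {t : ℕ}
    (ht : L.length = t) : ∃ B : Fin t → Set V, T.IsBagChain l c B := by
  subst ht
  choose B hB hBl using fun i : Fin L.length =>
    T.exists_subset_omega_eq (L.get i) (hLl _ (L.get_mem i))
  have hF : ∀ i j, i < j → T.Forward c (B i) (B j) := fun i j hij =>
    (List.pairwise_iff_get.1 hL i j hij).mono (hB i) (hB j)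
  refine ⟨B, hl, hc, ?_, hBl, fun i j hij => (hF i j hij).2.1, fun i j hij => (hF i j hij).2.2⟩
  intro i j hij
  rcases lt_or_gt_of_ne hij with h | h
  · exact (hF i j h).1
  · exact (hF j i h).1.symm

end Forward
end Tournament

namespace Tournament

/-! ### The bag-chain constant -/

section Constant

variable {V : Type u} (T : Tournament V)

theorem contains_iff_hasCopy {W : Type v} {H : Tournament W} :
    T.Contains H ↔ T.HasCopy H Set.univ := by
  constructor
  · rintro ⟨e⟩
    exact ⟨e, fun _ => trivial, fun a b h => e.map_rel_iff.2 h⟩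
  · rintro ⟨φ, -, h⟩
    exact T.contains_of_hom φ h

theorem induce_contains_iff {W : Type v} {H : Tournament W} {S : Set V} :
    (T.induce S).Contains H ↔ T.HasCopy H S := by
  rw [contains_iff_hasCopy]
  constructor
  · rintro ⟨φ, -, h⟩
    exact ⟨fun a => (φ a).1, fun a => (φ a).2, h⟩
  · rintro ⟨φ, h1, h2⟩
    exact ⟨fun a => ⟨φ a, h1 a⟩, fun _ => trivial, h2⟩

theorem card_DVert_succ_le (n : ℕ) : Nat.card (DVert n) + 1 ≤ 2 ^ n := by
  induction n with
  | zero =>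
    have : Nat.card (DVert 0) = 0 := Nat.card_of_isEmpty (α := Empty)
    omega
  | succ n ih =>
    have h : Nat.card (DVert (n + 1)) = Nat.card (DVert n) + (Nat.card (DVert n) + 1) := by
      have := finite_DVert n
      change Nat.card (DVert n ⊕ DVert n ⊕ Unit) = _
      rw [Nat.card_sum, Nat.card_sum, Nat.card_unique (α := Unit)]
    rw [h, pow_succ]
    omega

theorem HasCopy.exists_finset {T : Tournament V} {W : Type v} [Finite W] {H : Tournament W}
    {X : Set V} (h : T.HasCopy H X) :
    ∃ M : Finset V, ↑M ⊆ X ∧ M.card ≤ Nat.card W ∧ T.HasCopy H M := by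
  classical
  have := Fintype.ofFinite W
  obtain ⟨φ, h1, h2⟩ := h
  refine ⟨Finset.univ.image φ, ?_, ?_, φ, fun a => by simp, h2⟩
  · intro x hx
    obtain ⟨a, -, rfl⟩ := Finset.mem_image.1 (Finset.mem_coe.1 hx)
    exact h1 a
  · rw [Nat.card_eq_fintype_card]
    exact Finset.card_image_le

theorem LargeSubContain.hasCopy [Finite V] {T : Tournament V} {W : Type v} {H : Tournament W}
    {c : ℕ} (h : T.LargeSubContain c H) (hc : 0 < c) {X : Set V} (hX : c ≤ T.omega X) :
    T.HasCopy H X :=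
  T.induce_contains_iff.1 (h X (T.nonempty_of_omega_pos (hc.trans_le hX)) hX)

theorem deltaFree_of_not_contains [Finite V] {n c : ℕ} (hc : 0 < c)
    (hD : ¬ T.Contains (D (n + 1))) (hL : T.LargeSubContain c (D n)) :
    T.DeltaFree (T.HasCopy (D n)) c (2 ^ n - 1) := by
  refine ⟨fun X Y hXY h => h.mono hXY, fun X hX => ?_, fun v X Y hX hY hXY hDX hDY => ?_⟩
  · obtain ⟨M, h1, h2, h3⟩ := (hL.hasCopy hc hX).exists_finset
    have := card_DVert_succ_le n
    exact ⟨M, h1, by omega, h3⟩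
  · rw [contains_iff_hasCopy, hasCopy_D_succ_iff] at hD
    exact hD ⟨v, trivial, X, Y, Set.subset_univ _, Set.subset_univ _, hDX, hDY, hXY, hX, hY⟩

theorem DeltaFree.le {T : Tournament V} {Φ : Set V → Prop} {c s s' : ℕ} (h : T.DeltaFree Φ c s)
    (hs : s ≤ s') : T.DeltaFree Φ c s' :=
  ⟨h.mono, fun X hX => by
    obtain ⟨M, h1, h2, h3⟩ := h.exists_small X hX
    exact ⟨M, h1, h2.trans hs, h3⟩, h.no_delta⟩

/-- `D_2` is the cyclic triangle, so `T` is transitive, and ranking by in-degree leaves no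
backedges. -/
theorem omega_le_one_of_not_contains [Finite V] (h : ¬ T.Contains (D 2)) (X : Set V) :
    T.omega X ≤ 1 := by
  classical
  have := Fintype.ofFinite V
  have hone : ∀ x : V, T.HasCopy (D 1) {x} := fun x => T.hasCopy_D_succ_iff.2
    ⟨x, rfl, ∅, ∅, by simp, by simp, T.hasCopy_D_zero, T.hasCopy_D_zero,
      fun x hx => hx.elim, by simp, by simp⟩
  have htr : ∀ u y x, T.Adj u y → T.Adj y x → T.Adj u x := by
    intro u y x huy hyx
    refine T.adj_of_not_adj (fun hxu => ?_) fun hxu => h ?_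
    · rw [hxu] at hyx
      exact T.asymm _ _ huy hyx
    · refine T.contains_iff_hasCopy.2 (T.hasCopy_D_succ_iff.2 ⟨x, trivial, {u}, {y},
        Set.subset_univ _, Set.subset_univ _, hone u, hone y, ?_, ?_, ?_⟩)
      · rintro _ rfl _ rfl
        exact huy
      · rintro _ rfl
        exact hxu
      · rintro _ rfl
        exact hyx
  let f : V → ℕ := fun v => (Finset.univ.filter fun u => T.Adj u v).card
  have hlt : ∀ x y, T.Adj y x → f y < f x := by
    intro x y hyx
    refine Finset.card_lt_card ⟨fun u hu => ?_, fun hs => ?_⟩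
    · simp only [Finset.mem_filter, Finset.mem_univ, true_and] at hu ⊢
      exact htr _ _ _ hu hyx
    · have := hs (Finset.mem_filter.2 ⟨Finset.mem_univ y, hyx⟩)
      exact T.irrefl y (Finset.mem_filter.1 this).2
  refine (T.omega_le_iff X 1).2 ⟨f, ?_, ?_⟩
  · intro a _ b _ hab
    by_contra hne
    rcases T.total a b hne with h' | h'
    · exact absurd hab (hlt _ _ h').ne
    · exact absurd hab (hlt _ _ h').ne'
  · intro Q _ hc
    refine Finset.card_le_one.2 fun a ha b hb => ?_
    by_contra hne
    rcases T.total a b hne with h' | h'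
    · exact T.asymm _ _ h' (hc a ha b hb (hlt _ _ h'))
    · exact T.asymm _ _ h' (hc b hb a ha (hlt _ _ h'))

/-- With `c = 0`, even a single vertex must contain `D_{n-1}`, which forces `n = 2` unless `T` is
empty. -/
theorem isBagChainConstant_two {n l : ℕ} (hn : 2 ≤ n) : IsBagChainConstant.{u} n l 0 2 := by
  intro V _ T hL
  by_cases hV : Nonempty V
  · obtain ⟨v⟩ := hV
    have hcopy := T.induce_contains_iff.1 (hL {v} ⟨v, rfl⟩ (Nat.zero_le _))
    obtain rfl | ⟨m, rfl⟩ : n = 2 ∨ ∃ m, n = m + 3 := by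
      rcases Nat.lt_or_ge 2 n with h | h
      · exact Or.inr ⟨n - 3, by omega⟩
      · exact Or.inl (by omega)
    · by_cases hD : T.Contains (D 2)
      · exact Or.inr (Or.inl hD)
      · left
        rw [cliqueNumber_eq_omega]
        exact Nat.lt_succ_of_le (T.omega_le_one_of_not_contains hD _)
    · obtain ⟨x, hx, X, Y, hX, -, hDX, -, -, hxX, -⟩ :=
        T.hasCopy_D_succ_iff.1 (show T.HasCopy (D (m + 1 + 1)) {v} from hcopy)
      obtain ⟨y, hy, -⟩ := T.hasCopy_D_succ_iff.1 hDX
      exact absurd ((hX hy).trans (Eq.symm hx)).symm (T.ne_of_adj (hxX y hy))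
  · left
    rw [cliqueNumber_eq_omega]
    have : (Set.univ : Set V) = ∅ := by
      ext x
      exact absurd ⟨x⟩ hV
    rw [this, omega_empty]
    norm_num

theorem exists_isBagChainConstant (l c : ℕ) : ∃ K : ℕ, ∀ n, 2 ≤ n → (0 < l ∨ c = 0) →
    IsBagChainConstant.{u} n l c K := by
  rcases Nat.eq_zero_or_pos c with rfl | hc
  · exact ⟨2, fun n hn _ => isBagChainConstant_two hn⟩
  obtain ⟨n₀, hn₀⟩ := exists_lt_omega_of_hasCopy_D.{u} c
  obtain ⟨w, hw⟩ := exists_forward_list.{u} l c (2 ^ n₀) 3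
  refine ⟨max (w + 1) c, fun n hn hl V _ T hL => ?_⟩
  have hl : 0 < l := hl.resolve_right hc.ne'
  obtain ⟨n, rfl⟩ : ∃ m, n = m + 1 := ⟨n - 1, by omega⟩
  rw [Nat.add_sub_cancel] at hL
  by_contra hcon
  push Not at hcon
  obtain ⟨hlarge, hD, hno⟩ := hcon
  rw [cliqueNumber_eq_omega] at hlarge
  -- A set of clique number exactly `c` exists and contains `D n`; for `n ≥ n₀` its clique number
  -- would exceed `c`. This bounds `|D n|` independently of `n`.
  have hnn : n < n₀ := by
    by_contra hge
    obtain ⟨S, -, hS⟩ := T.exists_subset_omega_eq Set.univ ((le_max_right _ _).trans hlarge)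
    exact absurd hS (hn₀ V T S ((hL.hasCopy hc hS.ge).D_le (not_lt.1 hge))).ne'
  have hpow : 2 ^ n - 1 ≤ 2 ^ n₀ :=
    (Nat.sub_le _ _).trans (Nat.pow_le_pow_right (by norm_num) hnn.le)
  obtain ⟨L, hLlen, hLp, hLl⟩ := hw V T _ ((T.deltaFree_of_not_contains hc hD hL).le hpow) Set.univ
    ((le_max_left _ _).trans hlarge)
  obtain ⟨B, hB⟩ := T.exists_isBagChain_of_list hl hc hLp (fun B hB => (hLl B hB).2)
    (t := 8) hLlen
  exact hno B hB

theorem IsBagChainConstant.mono {n l c K K' : ℕ} (h : IsBagChainConstant.{u} n l c K)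
    (hK : K ≤ K') : IsBagChainConstant.{u} n l c K' :=
  fun V _ T hL => (h V T hL).imp_left fun h' => h'.trans_le hK

theorem exists_monotone_isBagChainConstant : ∃ C : ℕ → ℕ → ℕ,
    (∀ l l' c c' : ℕ, l ≤ l' → c ≤ c' → C l c ≤ C l' c') ∧
    ∀ n l c : ℕ, 2 ≤ n → (0 < l ∨ c = 0) → IsBagChainConstant.{u} n l c (C l c) := by
  choose K hK using exists_isBagChainConstant.{u}
  -- Summing over all smaller pairs gives a monotone majorant.
  refine ⟨fun l c => ∑ i ∈ Finset.range (l + 1), ∑ j ∈ Finset.range (c + 1), K i j, ?_, ?_⟩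
  · intro l l' c c' hl hc
    refine (Finset.sum_le_sum fun i _ => Finset.sum_le_sum_of_subset
      (Finset.range_subset_range.2 (Nat.succ_le_succ hc))).trans
      (Finset.sum_le_sum_of_subset (Finset.range_subset_range.2 (Nat.succ_le_succ hl)))
  · intro n l c hn h
    refine (hK l c n hn h).mono ?_
    refine le_trans ?_ (Finset.single_le_sum (f := fun i => ∑ j ∈ Finset.range (c + 1), K i j)
      (fun i _ => Nat.zero_le _) (Finset.self_mem_range_succ l))
    exact Finset.single_le_sum (f := fun j => K l j) (fun j _ => Nat.zero_le _)
      (Finset.self_mem_range_succ c)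

end Constant
end Tournament

namespace Tournament

/-! ### Positions relative to a longest bag-chain, and layers -/

section Layering

variable {V : Type u} {T : Tournament V}

/-- Otherwise `N⁻(w) ∩ R` contains a small `M` with `Φ`. The out-neighbours of `M` take at most `s *
c` away from `N⁺(w) ∩ B`; the rest has clique number at least `c`, is dominated by `w` and dominates
`M`, while `M` dominates `w`. -/
theorem DeltaFree.omega_inNbr_inter_lt [Finite V] {Φ : Set V → Prop} {c s : ℕ}
    (h : T.DeltaFree Φ c s) {w : V} {B R : Set V} (hB : (s + 1) * c ≤ T.omega (T.outNbr w ∩ B))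
    (hR : ∀ v ∈ R, T.omega (T.outNbr v ∩ B) < c) : T.omega (T.inNbr w ∩ R) < c := by
  by_contra hcon
  obtain ⟨M, hM, hMs, hΦ⟩ := h.exists_small _ (not_lt.1 hcon)
  have h1 := T.omega_le_diff_biUnion (T.outNbr w ∩ B) M T.outNbr c s hMs fun m hm =>
    (T.omega_mono (Set.inter_subset_inter_right _ Set.inter_subset_right)).trans
      (hR m (hM hm).2).le
  rw [Nat.succ_mul] at hB
  refine h.no_delta w ((T.outNbr w ∩ B) \ ⋃ m ∈ M, T.outNbr m) M (fun x hx => hx.1.1)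
    (fun x hx => (hM hx).1) ?_ (h.of_le_omega (by omega)) hΦ
  intro x hx m hm
  refine T.adj_of_not_adj (fun hmx => ?_) fun hmx => hx.2 (Set.mem_biUnion hm hmx)
  exact T.asymm _ _ hx.1.1 (hmx ▸ (hM hm).1)

theorem DeltaFree.omega_outNbr_inter_lt [Finite V] {Φ : Set V → Prop} {c s : ℕ}
    (h : T.DeltaFree Φ c s) {v : V} {B P : Set V} (hB : (s + 1) * c ≤ T.omega (T.inNbr v ∩ B))
    (hP : ∀ w ∈ P, T.omega (T.inNbr w ∩ B) < c) : T.omega (T.outNbr v ∩ P) < c := by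
  by_contra hcon
  obtain ⟨M, hM, hMs, hΦ⟩ := h.exists_small _ (not_lt.1 hcon)
  have h1 := T.omega_le_diff_biUnion (T.inNbr v ∩ B) M T.inNbr c s hMs fun m hm =>
    (T.omega_mono (Set.inter_subset_inter_right _ Set.inter_subset_right)).trans
      (hP m (hM hm).2).le
  rw [Nat.succ_mul] at hB
  refine h.no_delta v M ((T.inNbr v ∩ B) \ ⋃ m ∈ M, T.inNbr m) (fun x hx => (hM hx).1)
    (fun x hx => hx.1.1) ?_ hΦ (h.of_le_omega (by omega))
  intro m hm x hx
  refine T.adj_of_not_adj (fun hmx => ?_) fun hmx => hx.2 (Set.mem_biUnion hm hmx)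
  exact T.asymm _ _ hx.1.1 (hmx ▸ (hM hm).1)

theorem omega_le_outNbr_add_inNbr [Finite V] (T : Tournament V) {v : V} {B : Set V} (hv : v ∉ B) :
    T.omega B ≤ T.omega (T.outNbr v ∩ B) + T.omega (T.inNbr v ∩ B) := by
  refine (T.omega_mono fun x hx => ?_).trans (T.omega_union_le _ _)
  rcases T.total v x (fun h => hv (h ▸ hx)) with h | h
  · exact Or.inl ⟨h, hx⟩
  · exact Or.inr ⟨h, hx⟩

/-- A position of every vertex relative to the bags of a bag-chain. -/
theorem DeltaFree.exists_zone [Finite V] {Φ : Set V → Prop} {c s t : ℕ} (h : T.DeltaFree Φ c s)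
    {B : ℕ → Set V} (hF : ∀ i j, i < j → j < t → T.Forward c (B i) (B j))
    (hB : ∀ i < t, 2 * ((s + 1) * c) ≤ T.omega (B i)) :
    ∃ z : V → ℕ, (∀ v, z v ≤ t) ∧ (∀ p < t, ∀ v ∈ B p, z v = p) ∧
      (∀ v, ∀ i < z v, T.omega (T.outNbr v ∩ B i) < c) ∧
      ∀ v j, z v + 2 ≤ j → j < t → T.omega (T.inNbr v ∩ B j) < c := by
  classical
  -- The position of `v` is the first bag that contains `v` or in which `v` has many out-neighbours,
  -- with `t` as default.
  let P : V → ℕ → Prop := fun v i => i = t ∨ v ∈ B i ∨ c ≤ T.omega (T.outNbr v ∩ B i)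
  have hP : ∀ v, ∃ i, P v i := fun v => ⟨t, Or.inl rfl⟩
  have hle : ∀ v, Nat.find (hP v) ≤ t := fun v => Nat.find_min' (hP v) (Or.inl rfl)
  have hmem : ∀ p < t, ∀ v ∈ B p, Nat.find (hP v) = p := by
    intro p hp v hv
    refine (Nat.find_eq_iff (hP v)).2 ⟨Or.inr (Or.inl hv), fun i hi => ?_⟩
    rintro (h' | h' | h')
    · omega
    · exact Set.disjoint_left.1 (hF i p hi hp).1 h' hv
    · exact absurd ((hF i p hi hp).2.1 v hv) (not_lt.2 h')
  refine ⟨fun v => Nat.find (hP v), hle, hmem, fun v i hi => ?_, fun v j hj hjt => ?_⟩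
  · by_contra hcon
    exact Nat.find_min (hP v) hi (Or.inr (Or.inr (not_lt.1 hcon)))
  · replace hj : Nat.find (hP v) + 2 ≤ j := hj
    set p := Nat.find (hP v)
    rcases Nat.find_spec (hP v) with h' | h' | h'
    · omega
    · exact (hF p j (by omega) hjt).2.2 v h'
    · have hv : v ∉ B (p + 1) := fun hv => by
        have := hmem (p + 1) (by omega) v hv
        omega
      -- Many in-neighbours in bag `p + 1` would leave few out-neighbours in bag `p`. So `v` has
      -- many out-neighbours in bag `p + 1`, and hence few in-neighbours in all later bags.
      have h1 : T.omega (T.inNbr v ∩ B (p + 1)) < (s + 1) * c := by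
        by_contra hcon
        refine absurd (h.omega_outNbr_inter_lt (not_lt.1 hcon) fun w hw => ?_) (not_lt.2 h')
        exact (hF p (p + 1) (by omega) (by omega)).2.2 w hw
      have h2 := T.omega_le_outNbr_add_inNbr hv
      have h3 := hB (p + 1) (by omega)
      exact h.omega_inNbr_inter_lt (B := B (p + 1)) (by omega)
        (hF (p + 1) j (by omega) hjt).2.1

/-- A bag strictly between the positions serves as a witness: bag `z v - 1` for a vertex `v ∈ R`,
bag `z w + 2` for a vertex `w ∈ P`. A gap of three makes every vertex of the other set lie clearly
on the opposite side of this bag. -/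
theorem DeltaFree.forward_of_zone [Finite V] {Φ : Set V → Prop} {c s t : ℕ}
    (h : T.DeltaFree Φ c s) (hc : 0 < c) {B : ℕ → Set V}
    (hB : ∀ i < t, 2 * ((s + 1) * c) ≤ T.omega (B i)) {z : V → ℕ} (hzt : ∀ v, z v ≤ t)
    (hzB : ∀ p < t, ∀ v ∈ B p, z v = p) (hzo : ∀ v, ∀ i < z v, T.omega (T.outNbr v ∩ B i) < c)
    (hzi : ∀ v j, z v + 2 ≤ j → j < t → T.omega (T.inNbr v ∩ B j) < c) {P R : Set V}
    (hPR : ∀ v ∈ P, ∀ w ∈ R, z v + 3 ≤ z w) : T.Forward c P R := by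
  have hcs : c ≤ (s + 1) * c := Nat.le_mul_of_pos_left _ (Nat.succ_pos _)
  refine ⟨Set.disjoint_left.2 fun v hv hv' => ?_, fun v hv => ?_, fun w hw => ?_⟩
  · have := hPR v hv v hv'
    omega
  · rcases P.eq_empty_or_nonempty with rfl | ⟨w, hw⟩
    · simpa [omega_empty] using hc
    have h1 := hPR w hw v hv
    have h2 := hzt v
    have h3 := hzo v (z v - 1) (by omega)
    have h4 := T.omega_le_outNbr_add_inNbr (v := v) (B := B (z v - 1)) fun hv' => by
      have := hzB (z v - 1) (by omega) v hv'
      omega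
    have h5 := hB (z v - 1) (by omega)
    refine h.omega_outNbr_inter_lt (B := B (z v - 1)) (by omega) fun w hw => ?_
    have := hPR w hw v hv
    exact hzi w _ (by omega) (by omega)
  · rcases R.eq_empty_or_nonempty with rfl | ⟨v, hv⟩
    · simpa [omega_empty] using hc
    have h1 := hPR w hw v hv
    have h2 := hzt v
    have h3 := hzi w (z w + 2) le_rfl (by omega)
    have h4 := T.omega_le_outNbr_add_inNbr (v := w) (B := B (z w + 2)) fun hv' => by
      have := hzB (z w + 2) (by omega) w hv'
      omega
    have h5 := hB (z w + 2) (by omega)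
    refine h.omega_inNbr_inter_lt (B := B (z w + 2)) (by omega) fun v hv => ?_
    have := hPR w hw v hv
    exact hzo v _ (by omega)

theorem exists_list_of_isBagChain_induce [Finite V] {S : Set V} {l c t : ℕ} {B : Fin t → Set S}
    (hB : (T.induce S).IsBagChain l c B) : ∃ E : List (Set V), E.length = t ∧
      E.Pairwise (T.Forward c) ∧ ∀ X ∈ E, X ⊆ S ∧ T.omega X = l := by
  refine ⟨List.ofFn fun i => Subtype.val '' B i, List.length_ofFn, ?_, ?_⟩
  · rw [List.pairwise_ofFn]
    intro i j hij
    refine ⟨(Set.disjoint_image_iff Subtype.val_injective).2 (hB.disjoint i j hij.ne), ?_, ?_⟩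
    · rintro _ ⟨v, hv, rfl⟩
      refine (T.omega_mono ?_).trans_lt
        ((T.omega_induce S _).symm.trans_lt (hB.omega_out_lt i j hij v hv))
      rintro _ ⟨hx, x, hx', rfl⟩
      exact ⟨x, ⟨hx, hx'⟩, rfl⟩
    · rintro _ ⟨v, hv, rfl⟩
      refine (T.omega_mono ?_).trans_lt
        ((T.omega_induce S _).symm.trans_lt (hB.omega_in_lt i j hij v hv))
      rintro _ ⟨hx, x, hx', rfl⟩
      exact ⟨x, ⟨hx, hx'⟩, rfl⟩
  · intro X hX
    obtain ⟨i, rfl⟩ := (List.mem_ofFn' _ _).1 hX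
    refine ⟨?_, (T.omega_induce S _).symm.trans (hB.omega_eq i)⟩
    rintro _ ⟨x, -, rfl⟩
    exact x.2

/-- Bags are disjoint and, as `l > 0`, nonempty. Hence they are distinct, which bounds the length.
-/
theorem exists_maximal_list [Finite V] (T : Tournament V) {l c : ℕ} (hl : 0 < l) :
    ∃ E : List (Set V), E.Pairwise (T.Forward c) ∧ (∀ X ∈ E, T.omega X = l) ∧
      ∀ E' : List (Set V), E'.Pairwise (T.Forward c) → (∀ X ∈ E', T.omega X = l) →
        E'.length ≤ E.length := by
  classical
  have := Fintype.ofFinite V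
  let S : Set ℕ := {k | ∃ E : List (Set V), E.Pairwise (T.Forward c) ∧ (∀ X ∈ E, T.omega X = l) ∧
    E.length = k}
  have hbdd : BddAbove S := by
    refine ⟨Fintype.card (Set V), ?_⟩
    rintro _ ⟨E, h1, h2, rfl⟩
    refine List.Nodup.length_le_card (h1.imp_of_mem fun {X Y} hX hY hXY hne => ?_)
    have h3 := hXY.1
    rw [← hne, disjoint_self] at h3
    have h4 := h2 X hX
    rw [h3, Set.bot_eq_empty, omega_empty] at h4
    omega
  obtain ⟨E, h1, h2, h3⟩ := Nat.sSup_mem (s := S) ⟨0, [], List.Pairwise.nil, by simp, rfl⟩ hbdd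
  refine ⟨E, h1, h2, fun E' h1' h2' => ?_⟩
  rw [h3]
  exact le_csSup hbdd ⟨E', h1', h2', rfl⟩

/-- The vertices have positions such that those with the same position contain no bag-chain of
length `8`, and those with positions far apart are arranged as in a bag-chain. -/
theorem DeltaFree.exists_position [Finite V] {Φ : Set V → Prop} {l c s : ℕ}
    (h : T.DeltaFree Φ c s) (hc : 0 < c) (hl : 2 * ((s + 1) * c) ≤ l) : ∃ z : V → ℕ,
      (∀ p, ∀ B : Fin 8 → Set {v | z v = p}, ¬ (T.induce {v | z v = p}).IsBagChain l c B) ∧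
      ∀ P R : Set V, (∀ v ∈ P, ∀ w ∈ R, z v + 3 ≤ z w) → T.Forward c P R := by
  have hcs : c ≤ (s + 1) * c := Nat.le_mul_of_pos_left _ (Nat.succ_pos _)
  obtain ⟨E, hE, hEl, hmax⟩ := T.exists_maximal_list (l := l) (c := c) (by omega)
  have hget : ∀ i (hi : i < E.length), E.getD i ∅ = E[i] := fun i hi => List.getD_eq_getElem _ _ hi
  have hω : ∀ i < E.length, 2 * ((s + 1) * c) ≤ T.omega (E.getD i ∅) := fun i hi => by
    rw [hget i hi, hEl _ (List.getElem_mem hi)]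
    exact hl
  obtain ⟨z, hzt, hzB, hzo, hzi⟩ := h.exists_zone (t := E.length) (B := fun i => E.getD i ∅)
    (fun i j hij hj => by
      simp only [hget i (hij.trans hj), hget j hj]
      exact List.pairwise_iff_getElem.1 hE i j (hij.trans hj) hj hij) hω
  have hfw : ∀ P R : Set V, (∀ v ∈ P, ∀ w ∈ R, z v + 3 ≤ z w) → T.Forward c P R :=
    fun P R => h.forward_of_zone hc hω hzt hzB hzo hzi
  refine ⟨z, fun p B hB => ?_, hfw⟩
  obtain ⟨F, hF8, hF, hFl⟩ := exists_list_of_isBagChain_induce hB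
  have hmem : ∀ X ∈ E, ∀ i (hi : i < E.length), E[i] = X → ∀ v ∈ X, z v = i := by
    rintro X - i hi rfl v hv
    exact hzB i hi v (by rw [hget i hi]; exact hv)
  -- At most the five bags `p - 2, …, p + 2` are replaced by eight. Truncated subtraction does no
  -- harm: for `p < 2` there are simply fewer bags to discard.
  have hlen := hmax (E.take (p - 2) ++ (F ++ E.drop (p + 3))) ?_ ?_
  · simp only [List.length_append, List.length_take, List.length_drop, hF8] at hlen
    omega
  · refine List.pairwise_append.2 ⟨hE.sublist (List.take_sublist _ _), List.pairwise_append.2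
      ⟨hF, hE.sublist (List.drop_sublist _ _), fun X hX Y hY => hfw X Y fun v hv w hw => ?_⟩,
      fun X hX Y hY => ?_⟩
    · obtain ⟨j, hj, rfl⟩ := List.mem_drop_iff_getElem.1 hY
      have h1 := hmem _ (List.getElem_mem (by omega)) _ _ rfl w hw
      have h2 : z v = p := (hFl X hX).1 hv
      omega
    · obtain ⟨i, hi, rfl⟩ := List.mem_take_iff_getElem.1 hX
      have hi' : i < E.length := by omega
      have h1 := hmem E[i] (List.getElem_mem hi') i hi' rfl
      rcases List.mem_append.1 hY with hY | hY
      · refine hfw _ Y fun v hv w hw => ?_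
        have h2 : z w = p := (hFl Y hY).1 hw
        have h3 := h1 v hv
        omega
      · obtain ⟨j, hj, rfl⟩ := List.mem_drop_iff_getElem.1 hY
        exact List.pairwise_iff_getElem.1 hE i (p + 3 + j) (by omega) (by omega) (by omega)
  · intro X hX
    rcases List.mem_append.1 hX with hX | hX
    · exact hEl X (List.mem_of_mem_take hX)
    rcases List.mem_append.1 hX with hX | hX
    · exact (hFl X hX).2
    · exact hEl X (List.mem_of_mem_drop hX)

/-- Consecutive values of `z` are merged so that each class except the last has clique number at
least `M`. -/
theorem exists_merge [Finite V] (T : Tournament V) {M : ℕ} (z : V → ℕ)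
    (hz : ∀ p, T.omega {v | z v = p} ≤ M) (r : ℕ) : ∃ g : ℕ → ℕ, Monotone g ∧
      (∀ p q, g (p + q) ≤ g p + q) ∧ (∀ p, r ≤ p → g p = g r) ∧
      T.omega {v | z v < r ∧ g (z v) = g r} ≤ M ∧
      (∀ a, T.omega {v | z v < r ∧ g (z v) = a} ≤ 2 * M) ∧
      ∀ a < g r, M ≤ T.omega {v | z v < r ∧ g (z v) = a} := by
  induction r with
  | zero => exact ⟨fun _ => 0, monotone_const, by simp, by simp, by simp [omega_empty],
      by simp [omega_empty], by simp⟩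
  | succ r ih =>
    obtain ⟨g, hg, hs, hr, hM, h2M, hgM⟩ := ih
    have hbig : T.omega {v | z v < r + 1 ∧ g (z v) = g r} ≤ 2 * M := by
      have h1 := T.omega_union_le {v | z v < r ∧ g (z v) = g r} {v | z v = r}
      have h2 := hz r
      refine (T.omega_mono ?_).trans (h1.trans (by omega))
      rintro v ⟨hv, hv'⟩
      rcases (Nat.lt_succ_iff_lt_or_eq.1 hv) with h | h
      · exact Or.inl ⟨h, hv'⟩
      · exact Or.inr h
    have hother : ∀ a, a ≠ g r → {v | z v < r + 1 ∧ g (z v) = a} = {v | z v < r ∧ g (z v) = a} := by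
      intro a ha
      ext v
      refine ⟨fun ⟨h1, h2⟩ => ⟨?_, h2⟩, fun ⟨h1, h2⟩ => ⟨by omega, h2⟩⟩
      rcases (Nat.lt_succ_iff_lt_or_eq.1 h1) with h | h
      · exact h
      · exact absurd (h ▸ h2).symm ha
    -- Position `r` joins the current class `g r`. If the class still has clique number at most `M`,
    -- it stays open; otherwise it is closed and the positions after `r` start a new class. Each
    -- position adds at most `M`, so no class exceeds `2 * M`.
    rcases le_total (T.omega {v | z v < r + 1 ∧ g (z v) = g r}) M with hle | hge
    · refine ⟨g, hg, hs, fun p hp => ?_, ?_, fun a => ?_, fun a ha => ?_⟩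
      · rw [hr p (by omega), hr (r + 1) (by omega)]
      · rwa [hr (r + 1) (by omega)]
      · by_cases ha : a = g r
        · rw [ha]
          exact hbig
        · rw [hother a ha]
          exact h2M a
      · rw [hr (r + 1) (by omega)] at ha
        rw [hother a ha.ne]
        exact hgM a ha
    · have hset : ∀ a, {v | z v < r + 1 ∧ (if z v ≤ r then g (z v) else g r + 1) = a} =
          {v | z v < r + 1 ∧ g (z v) = a} := by
        intro a
        ext v
        refine and_congr_right fun hv => ?_
        rw [if_pos (Nat.lt_succ_iff.1 hv)]
      refine ⟨fun p => if p ≤ r then g p else g r + 1, ?_, fun p q => ?_, fun p hp => ?_, ?_,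
        fun a => ?_, fun a ha => ?_⟩
      · intro p q hpq
        have h1 := hg hpq
        dsimp only
        split_ifs with h2 h3 h3
        · exact h1
        · exact (hg h2).trans (Nat.le_succ _)
        · omega
        · exact le_rfl
      · dsimp only
        rcases Nat.eq_zero_or_pos q with rfl | hq
        · simp
        have h1 := hs p q
        split_ifs with h2 h3 h3
        · exact h1
        · omega
        · have h4 := hs p (r - p)
          rw [Nat.add_sub_cancel' h3] at h4
          omega
        · omega
      · dsimp only
        rw [if_neg (by omega), if_neg (by omega)]
      · dsimp only
        rw [hset, if_neg (by omega), hother _ (by omega)]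
        refine (T.omega_mono (Y := ∅) ?_).trans (by simp [omega_empty])
        rintro v ⟨hv, hv'⟩
        have := hg hv.le
        omega
      · rw [hset]
        by_cases ha : a = g r
        · rw [ha]
          exact hbig
        · rw [hother a ha]
          exact h2M a
      · rw [hset]
        dsimp only at ha
        rw [if_neg (by omega)] at ha
        by_cases ha' : a = g r
        · rw [ha']
          exact hge
        · rw [hother a ha']
          exact hgM a (by omega)

/-- The vertices are divided into consecutive layers. -/
theorem DeltaFree.exists_layers [Finite V] {Φ : Set V → Prop} {l c s M : ℕ}
    (h : T.DeltaFree Φ c s) (hc : 0 < c) (hl : 2 * ((s + 1) * c) ≤ l)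
    (hM : ∀ S : Set V, (∀ B : Fin 8 → Set S, ¬ (T.induce S).IsBagChain l c B) → T.omega S ≤ M) :
    ∃ f : V → ℕ, (∀ a, T.omega {v | f v = a} ≤ 2 * M) ∧
      (∀ v, ∀ a < f v, M ≤ T.omega {v | f v = a}) ∧
      ∀ P R : Set V, (∀ v ∈ P, ∀ w ∈ R, f v + 3 ≤ f w) → T.Forward c P R := by
  obtain ⟨z, hz, hF⟩ := h.exists_position hc hl
  obtain ⟨r, hr⟩ := (Set.finite_range z).bddAbove
  have hr' : ∀ v, z v < r + 1 := fun v => Nat.lt_succ_of_le (hr ⟨v, rfl⟩)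
  obtain ⟨g, hg, hs, -, -, h2M, hgM⟩ := T.exists_merge z (fun p => hM _ (hz p)) (r + 1)
  simp only [hr', true_and] at h2M hgM
  refine ⟨fun v => g (z v), h2M, fun v a ha => hgM a (ha.trans_le (hg (hr' v).le)),
    fun P R hPR => hF P R fun v hv w hw => ?_⟩
  have h1 : g (z v) + 3 ≤ g (z w) := hPR v hv w hw
  -- `g` rises by at most one per position, so layers three apart come from positions at least three
  -- apart.
  by_contra hcon
  rcases le_total (z w) (z v) with h2 | h2
  · have := hg h2
    omega
  · have h3 := hs (z v) (z w - z v)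
    rw [Nat.add_sub_cancel' h2] at h3
    omega

end Layering
end Tournament

namespace Tournament

/-! ### Building `A_m` from a clique that meets many layers -/

section Interleave

variable {V : Type u} {T : Tournament V}

theorem exists_spread (d k : ℕ) (I : Finset ℕ) (hI : k * d < I.card) :
    ∃ a : ℕ → ℕ, (∀ i ≤ k, a i ∈ I) ∧ ∀ i < k, a i + d ≤ a (i + 1) := by
  induction k generalizing I with
  | zero =>
    obtain ⟨x, hx⟩ := Finset.card_pos.1 (by omega : 0 < I.card)
    exact ⟨fun _ => x, fun _ _ => hx, by simp⟩
  | succ k ih =>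
    have hne : I.Nonempty := Finset.card_pos.1 (by omega)
    set b := I.min' hne
    -- Choosing the minimum `b` rules out only the at most `d` elements in `[b, b + d)`.
    have h1 : I.card ≤ (I.filter fun x => b + d ≤ x).card + d := by
      rw [← Finset.card_filter_add_card_filter_not (s := I) fun x => b + d ≤ x]
      refine Nat.add_le_add_left ?_ _
      calc _ ≤ (Finset.Ico b (b + d)).card := Finset.card_le_card fun x hx => by
            obtain ⟨hx, hx'⟩ := Finset.mem_filter.1 hx
            exact Finset.mem_Ico.2 ⟨I.min'_le x hx, not_le.1 hx'⟩
        _ = d := by simp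
    obtain ⟨a, ha, had⟩ := ih _ (by rw [Nat.succ_mul] at hI; omega :
      k * d < (I.filter fun x => b + d ≤ x).card)
    refine ⟨fun i => Nat.casesOn i b a, fun i hi => ?_, fun i hi => ?_⟩
    · cases i with
      | zero => exact I.min'_mem hne
      | succ i => exact (Finset.mem_filter.1 (ha i (by omega))).1
    · cases i with
      | zero => exact (Finset.mem_filter.1 (ha 0 (by omega))).2
      | succ i => exact had i (by omega)

/-- A copy of `H` in the layer `b` that is placed correctly with respect to the vertices of `F`. -/
theorem exists_copy_in_layer [Finite V] {W : Type v} {H : Tournament W} {c : ℕ} {f : V → ℕ}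
    (hF : ∀ P R : Set V, (∀ v ∈ P, ∀ w ∈ R, f v + 3 ≤ f w) → T.Forward c P R)
    (hH : ∀ X : Set V, c ≤ T.omega X → T.HasCopy H X) (F : Finset V) (b : ℕ)
    (hFb : ∀ u ∈ F, f u + 3 ≤ b ∨ b + 3 ≤ f u)
    (hb : (F.card + 1) * c ≤ T.omega {v | f v = b}) :
    ∃ φ : W → V, (∀ x, f (φ x) = b) ∧ (∀ x y, H.Adj x y → T.Adj (φ x) (φ y)) ∧
      ∀ u ∈ F, ∀ x, (f u < b → T.Adj u (φ x)) ∧ (b < f u → T.Adj (φ x) u) := by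
  classical
  -- Each `u ∈ F` is at least three layers away, so the vertices on its wrong side have clique
  -- number below `c`. Removing them for all `u` costs at most `F.card * c` and leaves `c` for a
  -- copy of `H`.
  have h1 := T.omega_le_diff_biUnion {v | f v = b} F
    (fun u => if f u < b then T.inNbr u else T.outNbr u) c F.card le_rfl (by
      intro u hu
      rcases hFb u hu with h | h
      · rw [if_pos (by omega)]
        refine ((hF {u} {v | f v = b} ?_).2.2 u rfl).le
        rintro _ rfl w (rfl : f w = b)
        exact h
      · rw [if_neg (by omega)]
        refine ((hF {v | f v = b} {u} ?_).2.1 u rfl).le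
        rintro w (rfl : f w = b) _ rfl
        exact h)
  rw [Nat.succ_mul] at hb
  obtain ⟨φ, hφ, hhom⟩ := hH _ (by omega : c ≤ T.omega
    ({v | f v = b} \ ⋃ m ∈ F, if f m < b then T.inNbr m else T.outNbr m))
  have hfb : ∀ x, f (φ x) = b := fun x => (hφ x).1
  refine ⟨φ, hfb, hhom, fun u hu x => ⟨fun hlt => ?_, fun hlt => ?_⟩⟩
  · refine T.adj_of_not_adj (fun h => ?_) fun h => (hφ x).2 (Set.mem_biUnion hu ?_)
    · rw [← h, hfb] at hlt
      exact lt_irrefl _ hlt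
    · rw [if_pos hlt]
      exact h
  · refine T.adj_of_not_adj (fun h => ?_) fun h => (hφ x).2 (Set.mem_biUnion hu ?_)
    · rw [h, hfb] at hlt
      exact lt_irrefl _ hlt
    · rw [if_neg hlt.not_gt]
      exact h

/-- Copy `j` goes into layer `f (x j) + 3`, which is at least three layers from every `x i` and
every other copy. This layer lies below that of `x (j + 1)`, so it is full. At most `k * |W| + k +
1` vertices have to be respected, which with one more `c` for the copy explains `hkM`. -/
theorem exists_copies_in_layers [Finite V] {W : Type v} [Finite W] {H : Tournament W} {c k M : ℕ}
    {f : V → ℕ} (hF : ∀ P R : Set V, (∀ v ∈ P, ∀ w ∈ R, f v + 3 ≤ f w) → T.Forward c P R)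
    (hH : ∀ X : Set V, c ≤ T.omega X → T.HasCopy H X)
    (hM : ∀ v, ∀ a < f v, M ≤ T.omega {v | f v = a}) (hkM : (k * Nat.card W + k + 2) * c ≤ M)
    {x : ℕ → V} (hx : ∀ i j, i < j → j ≤ k → f (x i) + 6 ≤ f (x j)) (r : ℕ) (hr : r ≤ k) :
    ∃ φ : ℕ → W → V, ∀ j < r, (∀ a, f (φ j a) = f (x j) + 3) ∧
      (∀ a b, H.Adj a b → T.Adj (φ j a) (φ j b)) ∧
      (∀ i ≤ k, ∀ a, (i ≤ j → T.Adj (x i) (φ j a)) ∧ (j < i → T.Adj (φ j a) (x i))) ∧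
      ∀ i < j, ∀ a b, T.Adj (φ i a) (φ j b) := by
  classical
  have := Fintype.ofFinite W
  induction r with
  | zero => exact ⟨fun _ _ => x 0, by simp⟩
  | succ r ih =>
    obtain ⟨φ, hφ⟩ := ih (by omega)
    let F : Finset V := (Finset.range (k + 1)).image x ∪
      (Finset.range r ×ˢ Finset.univ).image fun p : ℕ × W => φ p.1 p.2
    have hFcard : F.card ≤ k * Nat.card W + k + 1 := by
      have h1 := Finset.card_union_le ((Finset.range (k + 1)).image x)
        ((Finset.range r ×ˢ Finset.univ).image fun p : ℕ × W => φ p.1 p.2)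
      have h2 := Finset.card_image_le (s := Finset.range (k + 1)) (f := x)
      have h3 := Finset.card_image_le (s := Finset.range r ×ˢ (Finset.univ : Finset W))
        (f := fun p : ℕ × W => φ p.1 p.2)
      rw [Finset.card_range] at h2
      rw [Finset.card_product, Finset.card_range, Finset.card_univ] at h3
      have h4 := Nat.mul_le_mul_right (Fintype.card W) (show r ≤ k by omega)
      rw [Nat.card_eq_fintype_card]
      change (_ ∪ _ : Finset V).card ≤ _
      omega
    have hxF : ∀ i ≤ k, x i ∈ F := fun i hi => Finset.mem_union_left _
      (Finset.mem_image_of_mem _ (Finset.mem_range.2 (Nat.lt_succ_of_le hi)))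
    have hφF : ∀ i < r, ∀ a, φ i a ∈ F := fun i hi a => Finset.mem_union_right _
      (Finset.mem_image.2 ⟨(i, a), by simpa using hi, rfl⟩)
    have hxr : ∀ i ≤ k, (i ≤ r → f (x i) + 3 ≤ f (x r) + 3) ∧
        (r < i → f (x r) + 3 + 3 ≤ f (x i)) := by
      intro i hi
      refine ⟨fun h => ?_, fun h => hx r i h hi⟩
      rcases h.eq_or_lt with rfl | h
      · exact le_rfl
      · have := hx i r h (by omega)
        omega
    have hφr : ∀ i < r, ∀ a, f (φ i a) + 3 ≤ f (x r) + 3 := by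
      intro i hi a
      have h1 := hx i r hi (by omega)
      have h2 := (hφ i hi).1 a
      omega
    obtain ⟨ψ, hψ, hhom, hψF⟩ := exists_copy_in_layer hF hH F (f (x r) + 3) (by
      intro u hu
      rcases Finset.mem_union.1 hu with hu | hu
      · obtain ⟨i, hi, rfl⟩ := Finset.mem_image.1 hu
        have hi' : i ≤ k := Nat.lt_succ_iff.1 (Finset.mem_range.1 hi)
        rcases le_or_gt i r with h | h
        · exact Or.inl ((hxr i hi').1 h)
        · exact Or.inr ((hxr i hi').2 h)
      · obtain ⟨⟨i, a⟩, hi, rfl⟩ := Finset.mem_image.1 hu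
        exact Or.inl (hφr i (by simpa using hi) a)) (by
      refine le_trans (Nat.mul_le_mul_right c (by omega)) (hkM.trans (hM (x (r + 1)) _ ?_))
      have := hx r (r + 1) (by omega) hr
      omega)
    refine ⟨Function.update φ r ψ, fun j hj => ?_⟩
    rcases Nat.lt_succ_iff_lt_or_eq.1 hj with hj | rfl
    · rw [Function.update_of_ne hj.ne]
      refine ⟨(hφ j hj).1, (hφ j hj).2.1, (hφ j hj).2.2.1, fun i hi a b => ?_⟩
      rw [Function.update_of_ne (by omega)]
      exact (hφ j hj).2.2.2 i hi a b
    · rw [Function.update_self]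
      refine ⟨hψ, hhom, fun i hi a => ⟨fun h => ?_, fun h => ?_⟩, fun i hi a b => ?_⟩
      · have := (hxr i hi).1 h
        exact (hψF _ (hxF i hi) a).1 (by omega)
      · have := (hxr i hi).2 h
        exact (hψF _ (hxF i hi) a).2 (by omega)
      · rw [Function.update_of_ne hi.ne]
        have := hφr i hi a
        exact (hψF _ (hφF i hi a) b).1 (by omega)

/-- Arcs of the interleaved tournament go backwards only among the `v_i`, which are taken from `Q`.
More than `6 * k` layers provide `k + 1` of them at distances at least six, leaving room for a layer
three away from both neighbours. -/
theorem contains_interleave_of_layers [Finite V] {W : Type v} [Finite W] {H : Tournament W}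
    {c k M : ℕ} {f : V → ℕ}
    (hF : ∀ P R : Set V, (∀ v ∈ P, ∀ w ∈ R, f v + 3 ≤ f w) → T.Forward c P R)
    (hH : ∀ X : Set V, c ≤ T.omega X → T.HasCopy H X)
    (hM : ∀ v, ∀ a < f v, M ≤ T.omega {v | f v = a}) (hkM : (k * Nat.card W + k + 2) * c ≤ M)
    {Q : Finset V} (hQ : ∀ x ∈ Q, ∀ y ∈ Q, f x < f y → T.Adj y x)
    (hQk : k * 6 < (Q.image f).card) : T.Contains (interleave H k) := by
  obtain ⟨a, haI, had⟩ := exists_spread 6 k (Q.image f) hQk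
  have hex : ∀ i, ∃ x : V, i ≤ k → x ∈ Q ∧ f x = a i := by
    intro i
    by_cases hi : i ≤ k
    · obtain ⟨x, hx, hxa⟩ := Finset.mem_image.1 (haI i hi)
      exact ⟨x, fun _ => ⟨hx, hxa⟩⟩
    · obtain ⟨x, -⟩ := Finset.mem_image.1 (haI 0 (Nat.zero_le _))
      exact ⟨x, fun h => absurd h hi⟩
  choose x hx using hex
  have hlt : ∀ i j, i < j → j ≤ k → f (x i) + 6 ≤ f (x j) := by
    intro i j hij
    induction j, hij using Nat.le_induction with
    | base =>
      intro hj
      rw [(hx i (by omega)).2, (hx (i + 1) hj).2]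
      exact had i hj
    | succ j hij ih =>
      intro hj
      have h1 := ih (by omega)
      have h2 := had j hj
      rw [← (hx j (by omega)).2, ← (hx (j + 1) hj).2] at h2
      omega
  obtain ⟨φ, hφ⟩ := exists_copies_in_layers hF hH hM hkM hlt k le_rfl
  refine T.contains_of_hom (Sum.elim (fun p => φ p.1 p.2) fun i => x i) ?_
  rintro (⟨i, y⟩ | i) (⟨j, z⟩ | j) h
  · rcases h with h | ⟨rfl, h⟩
    · exact (hφ j j.2).2.2.2 i h y z
    · exact (hφ i i.2).2.1 y z h
  · exact ((hφ i i.2).2.2.1 j (Nat.lt_succ_iff.1 j.2) y).2 h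
  · exact ((hφ j j.2).2.2.1 i (Nat.lt_succ_iff.1 i.2) z).1 h
  · have hij : (j : ℕ) < i := h
    have hi := Nat.lt_succ_iff.1 i.2
    have := hlt j i hij hi
    exact hQ _ (hx j (by omega)).1 _ (hx i hi).1 (lt_of_lt_of_le (by omega) this)

theorem finite_AVert (n : ℕ) : Finite (AVert n) := by
  induction n with
  | zero => exact inferInstanceAs (Finite Empty)
  | succ n ih => exact inferInstanceAs (Finite ((Fin n × AVert n) ⊕ Fin (n + 1)))

theorem card_AVert_succ (n : ℕ) : Nat.card (AVert (n + 1)) = n * Nat.card (AVert n) + n + 1 := by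
  have := finite_AVert n
  change Nat.card ((Fin n × AVert n) ⊕ Fin (n + 1)) = _
  rw [Nat.card_sum, Nat.card_prod, Nat.card_fin, Nat.card_fin, Nat.add_assoc]

theorem card_AVert_le (n : ℕ) : Nat.card (AVert n) ≤ 4 * n.factorial := by
  induction n with
  | zero =>
    have : Nat.card (AVert 0) = 0 := Nat.card_of_isEmpty (α := Empty)
    omega
  | succ n ih =>
    rw [card_AVert_succ, Nat.factorial_succ]
    have h1 := Nat.mul_le_mul_left n ih
    have h2 := Nat.self_le_factorial n
    have h3 := Nat.factorial_pos n
    nlinarith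

/-- Order the vertices layer by layer, optimally inside each layer. A clique meets at most `6 * k`
layers, in at most `N` vertices each. -/
theorem omega_le_of_interleave_free [Finite V] {W : Type v} [Finite W] {H : Tournament W}
    {c k M N : ℕ} {f : V → ℕ}
    (hF : ∀ P R : Set V, (∀ v ∈ P, ∀ w ∈ R, f v + 3 ≤ f w) → T.Forward c P R)
    (hH : ∀ X : Set V, c ≤ T.omega X → T.HasCopy H X)
    (hM : ∀ v, ∀ a < f v, M ≤ T.omega {v | f v = a}) (hkM : (k * Nat.card W + k + 2) * c ≤ M)
    (hN : ∀ a, T.omega {v | f v = a} ≤ N) (hfree : ¬ T.Contains (interleave H k)) :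
    T.omega Set.univ ≤ N * (k * 6) := by
  refine T.omega_le_of_parts Set.univ f (fun _ => N) _
    (fun a => (T.omega_mono fun v hv => hv.2).trans (hN a)) fun Q _ hQ hQN => ?_
  refine (Finset.card_le_mul_card_image Q N fun a _ => hQN a).trans (Nat.mul_le_mul_left _ ?_)
  by_contra hcon
  exact hfree (contains_interleave_of_layers hF hH hM hkM hQ (not_le.1 hcon))

end Interleave

/-! ### The bound for tournaments without `A_m` and `D_n` -/

section Main

variable {V : Type u} {T : Tournament V}

theorem LargeSubContain.induce [Finite V] {W : Type v} {H : Tournament W} {c : ℕ}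
    (h : T.LargeSubContain c H) (S : Set V) : (T.induce S).LargeSubContain c H := by
  intro X hX hXc
  rw [omega_induce] at hXc
  obtain ⟨φ, hφ, hhom⟩ := T.induce_contains_iff.1 (h _ (hX.image _) hXc)
  refine (T.induce S).induce_contains_iff.2 ?_
  choose ψ hψ hψφ using hφ
  refine ⟨ψ, hψ, fun a b hab => ?_⟩
  change T.Adj (ψ a).1 (ψ b).1
  rw [hψφ, hψφ]
  exact hhom a b hab

theorem cliqueNumber_le_of_free [Finite V] {m n cSmall cLarge K : ℕ} (hm : 2 ≤ m) (hn : 2 ≤ n)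
    (hcl : 2 ^ n * cSmall ≤ cLarge) (hK : IsBagChainConstant.{u} n cLarge cSmall K)
    (hA : ¬ T.Contains (A m)) (hD : ¬ T.Contains (D n)) (hLA : T.LargeSubContain cSmall (A (m - 1)))
    (hLD : T.LargeSubContain cSmall (D (n - 1))) :
    T.cliqueNumber ≤ 16 * m * max cLarge (max K ((4 * m.factorial + 1) * cSmall)) := by
  set M := max cLarge (max K ((4 * m.factorial + 1) * cSmall))
  have hKM : K ≤ M := (le_max_left _ _).trans (le_max_right _ _)
  -- For `cSmall = 0` there are no bag-chains, so admissibility of `K` alone bounds the clique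
  -- number.
  rcases Nat.eq_zero_or_pos cSmall with hc | hc
  · have hle : M ≤ 16 * m * M := Nat.le_mul_of_pos_left _ (by omega)
    rcases hK V T hLD with h | h | ⟨B, hB⟩
    · exact h.le.trans (hKM.trans hle)
    · exact absurd h hD
    · exact absurd hB.pos_right (by omega)
  obtain ⟨k, rfl⟩ : ∃ k, m = k + 1 := ⟨m - 1, by omega⟩
  obtain ⟨n, rfl⟩ : ∃ i, n = i + 1 := ⟨n - 1, by omega⟩
  rw [Nat.add_sub_cancel] at hLA hLD
  have hzone : ∀ S : Set V, (∀ B : Fin 8 → Set S, ¬ (T.induce S).IsBagChain cLarge cSmall B) →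
      T.omega S ≤ M := by
    intro S hS
    rcases hK S (T.induce S) (hLD.induce S) with h | h | ⟨B, hB⟩
    · exact h.le.trans hKM
    · exact absurd (T.contains_iff_hasCopy.2
        ((T.induce_contains_iff.1 h).mono (Set.subset_univ S))) hD
    · exact absurd hB (hS B)
  -- After the shift of `n`, the small sets have size `s = 2 ^ n - 1`, so `2 * (s + 1)` is exactly
  -- the assumed factor `2 ^ (n + 1)`.
  have hpow : 2 * ((2 ^ n - 1 + 1) * cSmall) ≤ cLarge := by
    rw [Nat.sub_add_cancel Nat.one_le_two_pow, ← Nat.mul_assoc, ← pow_succ']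
    exact hcl
  obtain ⟨f, h2M, hgM, hF⟩ :=
    (T.deltaFree_of_not_contains hc hD hLD).exists_layers hc hpow hzone
  have := finite_AVert k
  -- The factor is `|A_m| + 1`, and `|A_m| ≤ 4 * m!`.
  have hcard : (k * Nat.card (AVert k) + k + 2) * cSmall ≤ M := by
    refine le_trans (Nat.mul_le_mul_right _ ?_) ((le_max_right _ _).trans (le_max_right _ _))
    have h1 := card_AVert_le (k + 1)
    rw [card_AVert_succ] at h1
    omega
  rw [cliqueNumber_eq_omega]
  refine (omega_le_of_interleave_free hF (fun X hX => hLA.hasCopy hc hX) hgM hcard h2M hA).trans ?_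
  -- The bound obtained is `2 * M * (k * 6)` with `k = m - 1`, which is below `16 * m * M`.
  nlinarith [Nat.zero_le (k * M)]

end Main
end Tournament

theorem mainTheorem6 :
    (∃ C : ℕ → ℕ → ℕ,
      (∀ l l' c c' : ℕ, l ≤ l' → c ≤ c' → C l c ≤ C l' c') ∧
      ∀ n l c : ℕ, 2 ≤ n → (0 < l ∨ c = 0) →
        Tournament.IsBagChainConstant.{u} n l c (C l c)) ∧
    ∀ m n cSmall cLarge K : ℕ, 2 ≤ m → 2 ≤ n → 2 ^ n * cSmall ≤ cLarge →
      Tournament.IsBagChainConstant.{u} n cLarge cSmall K →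
      ∀ (V : Type u) [Finite V] (T : Tournament V),
        ¬ T.Contains (Tournament.A m) → ¬ T.Contains (Tournament.D n) →
        T.LargeSubContain cSmall (Tournament.A (m - 1)) →
        T.LargeSubContain cSmall (Tournament.D (n - 1)) →
        T.cliqueNumber ≤
          16 * m * max cLarge (max K ((4 * m.factorial + 1) * cSmall)) :=
  ⟨Tournament.exists_monotone_isBagChainConstant,
    fun _ _ _ _ _ hm hn hcl hK _ _ _ hA hD hLA hLD =>
      Tournament.cliqueNumber_le_of_free hm hn hcl hK hA hD hLA hLD⟩
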